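/- Let $r$ be a positive integer and let $X_1,X_2,\dots$ be independent real random variables with common distribution function $F$, where $F$ is continuous except possibly at $0$. Put $\beta_r=\mathbb{E}[X_1F^r(X_1)]$ and $h(x_1,\dots,x_{r+1})=\max(x_1,\dots,x_{r+1})$. For $n\ge 1$ let $$\widehat\beta_r=\frac1{r+1}\binom{n}{r+1}^{-1}\sum_{1\le i_1<\dots<i_{r+1}\le n}h(X_{i_1},\dots,X_{i_{r+1}}),$$ let $\widehat\beta_{r,k}$ be the same estimator computed from the $n-1$ observations other than $X_k$, and let $\widehat V_k=n\widehat\beta_r-(n-1)\widehat\beta_{r,k}$, $k=1,\dots,n$, be the jackknife pseudo-values. Let $$J(\beta_r)=\sup\Big\{\prod_{k=1}^np_k:\ p_k\ge0,\ \sum_{k=1}^np_k=1,\ \sum_{k=1}^np_k(\widehat V_k-\beta_r)=0\Big\}$$ be the jackknife empirical likelihood and $l(\beta_r)=\log\big(J(\beta_r)/n^{-n}\big)$ the jackknife empirical log-likelihood ratio (with any fixed real value, say $0$, if no such vector with all $p_k>0$ exists). Suppose that $\mathbb{E}\big[h^2(X_1,\dots,X_{r+1})\big]<\infty$ and that $\sigma^2=\mathrm{Var}(g(X_1))>0$,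 where $g(x)=\mathbb{E}\big[h(X_1,\dots,X_{r+1})\mid X_1=x\big]-\beta_r$. Then, with probability tending to $1$ as $n\to\infty$, there is a real $\lambda$ with $1+\lambda(\widehat V_k-\beta_r)>0$ for all $k$, $$\frac1n\sum_{k=1}^n\frac{\widehat V_k-\beta_r}{1+\lambda(\widehat V_k-\beta_r)}=0\quad\text{and}\quad l(\beta_r)=-\sum_{k=1}^n\log\big[1+\lambda(\widehat V_k-\beta_r)\big];$$ and $-2\,l(\beta_r)$ converges in distribution to $\chi^2(1)$ as $n\to\infty$. -/

import Mathlib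

open MeasureTheory ProbabilityTheory Filter Topology

namespace JEL

noncomputable section

/-- The probability weighted moment `β_r = E[X F(X)^r]` of a law `P` on `ℝ` with distribution
function `F`. -/
def pwm (r : ℕ) (P : Measure ℝ) : ℝ :=
  ∫ x, x * (cdf P x) ^ r ∂P

/-- The maximum of a nonempty finite family of reals. -/
def maxKernel {ι : Type*} [Fintype ι] (v : ι → ℝ) : ℝ :=
  ⨆ i, v i

/-- The estimator of `β_r` based on the observations `x i`, `i ∈ s`: it is `1 / (r + 1)` times the
U-statistic whose kernel is the maximum of `r + 1` observations. -/
def betaHat (r : ℕ) (x : ℕ → ℝ) (s : Finset ℕ) : ℝ :=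
  1 / ((r : ℝ) + 1) * (1 / ((s.card.choose (r + 1) : ℕ) : ℝ)) *
    ∑ A ∈ s.powersetCard (r + 1), maxKernel (fun i : A => x i)

/-- The `k`-th jackknife pseudo-value for the sample `x 0, …, x (n - 1)`. -/
def pseudoValue (r : ℕ) (x : ℕ → ℝ) (n k : ℕ) : ℝ :=
  (n : ℝ) * betaHat r x (Finset.range n)
    - ((n : ℝ) - 1) * betaHat r x ((Finset.range n).erase k)

/-- The empirical likelihood at `β` of the values `V`: the supremum of `∏ p k` over the probability
vectors `p` with `∑ p k (V k - β) = 0` (and `0` if there is no such vector). -/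
def empLik {n : ℕ} (V : Fin n → ℝ) (β : ℝ) : ℝ :=
  sSup {t : ℝ | ∃ p : Fin n → ℝ, (∀ k, 0 ≤ p k) ∧ ∑ k, p k = 1 ∧
    ∑ k, p k * (V k - β) = 0 ∧ t = ∏ k, p k}

/-- The empirical log-likelihood ratio: the logarithm of the ratio of `empLik V β` to the
unconstrained maximum `n⁻ⁿ`. -/
def logRatio {n : ℕ} (V : Fin n → ℝ) (β : ℝ) : ℝ :=
  Real.log (empLik V β / ((n : ℝ) ^ n)⁻¹)

/-- `t` is a Lagrange multiplier for the values `V` at `β`: the weights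
`(1 / n) (1 + t (V k - β))⁻¹` are positive, and they satisfy the estimating equation. -/
def IsMultiplier {n : ℕ} (V : Fin n → ℝ) (β t : ℝ) : Prop :=
  (∀ k, 0 < 1 + t * (V k - β)) ∧
    1 / (n : ℝ) * ∑ k, (V k - β) / (1 + t * (V k - β)) = 0

/-- The jackknife empirical log-likelihood ratio `l(β)` of the sample `x 0, …, x (n - 1)`. -/
def jelLogRatio (r : ℕ) (x : ℕ → ℝ) (n : ℕ) (β : ℝ) : ℝ :=
  logRatio (fun k : Fin n => pseudoValue r x n k) β

/-- The first-order projection `g(x) = E[max (X 0, …, X r) | X 0 = x] - β_r` of the kernel. -/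
def projection {Ω : Type*} [MeasurableSpace Ω] (μ : Measure Ω) [IsFiniteMeasure μ]
    (r : ℕ) (X : ℕ → Ω → ℝ) (x : ℝ) : ℝ :=
  (∫ y, y ∂(condDistrib (fun ω => maxKernel (fun j : Fin (r + 1) => X j ω)) (X 0) μ x))
    - pwm r (μ.map (X 0))

/-- The chi-square distribution with `d` degrees of freedom: the law of the sum of the squares of
`d` independent standard normal variables. -/
def chiSquare (d : ℕ) : Measure ℝ :=
  (Measure.pi (fun _ : Fin d => gaussianReal 0 1)).map (fun z => ∑ i, z i ^ 2)

instance (d : ℕ) : IsProbabilityMeasure (chiSquare d) :=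
  Measure.isProbabilityMeasure_map
    (Finset.measurable_sum _ fun i _ => (measurable_pi_apply i).pow_const 2).aemeasurable

end

end JEL

/-! The proof combines a deterministic expansion of the empirical log-likelihood ratio with limit
theorems for the pseudo-values. Put `a k = V k - β`, with mean `b`, mean square `S` and a bound `Z`
on all `|a k|`. A multiplier `t` identifies the maximising weights, so the log ratio is `-∑ log (1 +
t * a k)`. If `|b| * Z` is small compared with `S`, the estimating equation has a root close to `b /
S`, and expanding the logarithm shows that minus twice the log ratio is `n * b ^ 2 / S` up to a
relative error of order `|b| * Z / S` (`exists_isMultiplier`, `abs_neg_two_mul_logRatio_sub_le`).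

It remains to see that `√n * b` is asymptotically normal with variance `σ²`, that `S` tends to `σ²`,
and that `Z` can be taken of smaller order than `√n`. The jackknife linearises: `V k - β` is `proj
(X k)` plus a remainder of mean square `O(1 / n)` (`exists_integral_sq_pseudoValue_sub_le`). The
strong law for the squared projections then controls both `S` and `Z`. The mean of the pseudo-values
is the estimator itself; subtracting its linear part leaves a degenerate U-statistic with second
moment `O(1 / n ^ 2)` (`exists_integral_sq_uStat_sub_sum_le`), so the classical central limit
theorem applies. The variance bounds for U-statistics all come from `integral_uStat_sq_le`.

Continuity of the distribution function off `0` serves only to prove that the kernel has mean `(r +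
1) * β_r` (`meanMax_eq`): ties then occur almost surely only at the value `0`, where they contribute
nothing. -/

namespace JEL

/-! ### Deterministic analysis of the empirical likelihood. -/

section EmpiricalLikelihood

variable {n : ℕ} {V : Fin n → ℝ} {β t : ℝ}

/-- Since `1 / (1 + u) = 1 - u / (1 + u)`, the estimating equation already forces total mass one; no
second multiplier is needed. -/
theorem IsMultiplier.sum_weights (hn : 0 < n) (h : IsMultiplier V β t) :
    ∑ k, 1 / ((n : ℝ) * (1 + t * (V k - β))) = 1 := by
  have hn' : (n : ℝ) ≠ 0 := by positivity
  have h2 := h.2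
  have e : ∀ k, 1 / ((n : ℝ) * (1 + t * (V k - β)))
      = 1 / n - t * (1 / n * ((V k - β) / (1 + t * (V k - β)))) := by
    intro k
    have := (h.1 k).ne'
    field_simp
    ring
  rw [Finset.sum_congr rfl fun k _ => e k, Finset.sum_sub_distrib, ← Finset.mul_sum,
    ← Finset.mul_sum, h2]
  simp [hn']

theorem IsMultiplier.empLik_eq (hn : 0 < n) (h : IsMultiplier V β t) :
    empLik V β = ∏ k, 1 / ((n : ℝ) * (1 + t * (V k - β))) := by
  have hn' : (0 : ℝ) < n := by positivity
  refine IsGreatest.csSup_eq ⟨⟨_, fun k => ?_, h.sum_weights hn, ?_, rfl⟩, ?_⟩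
  · have := h.1 k
    positivity
  · rw [← h.2, Finset.mul_sum]
    refine Finset.sum_congr rfl fun k _ => ?_
    have := (h.1 k).ne'
    field_simp
  · rintro _ ⟨p, hp, hp1, hpV, rfl⟩
    -- The inequality `x ≤ exp (x - 1)` is applied to the ratios of competing to candidate weights.
    -- Both constraints are linear in `p`, so the exponents add up to `0`.
    have key : ∏ k, (p k * (n * (1 + t * (V k - β)))) ≤ 1 := by
      calc ∏ k, (p k * (n * (1 + t * (V k - β))))
          ≤ ∏ k, Real.exp (p k * (n * (1 + t * (V k - β))) - 1) := by
            refine Finset.prod_le_prod (fun k _ => ?_) fun k _ => ?_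
            · have := h.1 k
              have := hp k
              positivity
            · have := Real.add_one_le_exp (p k * (n * (1 + t * (V k - β))) - 1)
              linarith
        _ = 1 := by
            rw [← Real.exp_sum, Real.exp_eq_one_iff]
            have e : ∀ k, p k * (n * (1 + t * (V k - β))) - 1
                = n * p k + n * t * (p k * (V k - β)) - 1 := fun k => by ring
            simp_rw [e]
            rw [Finset.sum_sub_distrib, Finset.sum_add_distrib, ← Finset.mul_sum,
              ← Finset.mul_sum, hp1, hpV]
            simp
    have hpos : 0 < ∏ k, ((n : ℝ) * (1 + t * (V k - β))) :=
      Finset.prod_pos fun k _ => mul_pos hn' (h.1 k)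
    rw [Finset.prod_mul_distrib] at key
    rw [Finset.prod_div_distrib, Finset.prod_const_one]
    exact (le_div_iff₀ hpos).2 key

theorem IsMultiplier.logRatio_eq (hn : 0 < n) (h : IsMultiplier V β t) :
    logRatio V β = -∑ k, Real.log (1 + t * (V k - β)) := by
  have hn' : (n : ℝ) ≠ 0 := by positivity
  rw [logRatio, h.empLik_eq hn, ← Real.log_prod fun k _ => (h.1 k).ne', ← Real.log_inv]
  congr 1
  rw [Finset.prod_div_distrib, Finset.prod_const_one, Finset.prod_mul_distrib, Finset.prod_const]
  simp [hn']

/-- The remainder of each term is `t ^ 2 * a ^ 3 / (1 + t * a)`; the denominator is at least `1 /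
2`, and one factor `|a|` is traded for `Z`. -/
theorem abs_mean_div_sub_le {a : Fin n → ℝ} {Z : ℝ} (hZ : ∀ k, |a k| ≤ Z)
    (ht : |t| * Z ≤ 1 / 2) :
    |1 / (n : ℝ) * ∑ k, a k / (1 + t * a k)
        - (1 / (n : ℝ) * ∑ k, a k - t * (1 / (n : ℝ) * ∑ k, a k ^ 2))|
      ≤ 2 * t ^ 2 * Z * (1 / (n : ℝ) * ∑ k, a k ^ 2) := by
  have hk : ∀ k, |a k / (1 + t * a k) - (a k - t * a k ^ 2)| ≤ 2 * t ^ 2 * Z * a k ^ 2 := by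
    intro k
    have h1 : |t * a k| ≤ 1 / 2 := by
      rw [abs_mul]
      exact (mul_le_mul_of_nonneg_left (hZ k) (abs_nonneg _)).trans ht
    have h2 : 1 / 2 ≤ 1 + t * a k := by linarith [(abs_le.1 h1).1]
    have e : a k / (1 + t * a k) - (a k - t * a k ^ 2) = t ^ 2 * a k ^ 3 / (1 + t * a k) := by
      have : 1 + t * a k ≠ 0 := by linarith
      rw [eq_div_iff this, sub_mul, div_mul_cancel₀ _ this]
      ring
    rw [e, abs_div, abs_of_pos (by linarith : 0 < 1 + t * a k), div_le_iff₀ (by linarith)]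
    have h3 : |t ^ 2 * a k ^ 3| = t ^ 2 * a k ^ 2 * |a k| := by
      rw [abs_mul, abs_pow, abs_pow, sq_abs, pow_succ |a k| 2, sq_abs]
      ring
    rw [h3]
    have hZ0 : 0 ≤ Z := (abs_nonneg _).trans (hZ k)
    calc t ^ 2 * a k ^ 2 * |a k| ≤ t ^ 2 * a k ^ 2 * Z := by gcongr; exact hZ k
      _ = 2 * t ^ 2 * Z * a k ^ 2 * (1 / 2) := by ring
      _ ≤ _ := by gcongr
  have e : 1 / (n : ℝ) * ∑ k, a k / (1 + t * a k)
        - (1 / (n : ℝ) * ∑ k, a k - t * (1 / (n : ℝ) * ∑ k, a k ^ 2))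
      = 1 / (n : ℝ) * ∑ k, (a k / (1 + t * a k) - (a k - t * a k ^ 2)) := by
    simp only [Finset.sum_sub_distrib, ← Finset.mul_sum]
    ring
  rw [e, abs_mul, abs_of_nonneg (by positivity : 0 ≤ 1 / (n : ℝ))]
  calc 1 / (n : ℝ) * |∑ k, (a k / (1 + t * a k) - (a k - t * a k ^ 2))|
      ≤ 1 / (n : ℝ) * ∑ k, 2 * t ^ 2 * Z * a k ^ 2 := by
        gcongr
        exact (Finset.abs_sum_le_sum_abs _ _).trans (Finset.sum_le_sum fun k _ => hk k)
    _ = _ := by rw [← Finset.mul_sum]; ring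

/-- If the mean of the values `V k - β` is small with respect to their mean square and their
maximum, then there is a multiplier, of the size of the mean. -/
theorem exists_isMultiplier {a : Fin n → ℝ} {Z S b : ℝ} (ha : ∀ k, a k = V k - β)
    (hZ : ∀ k, |a k| ≤ Z) (hS : S = 1 / (n : ℝ) * ∑ k, a k ^ 2) (hb : b = 1 / (n : ℝ) * ∑ k, a k)
    (hS0 : 0 < S) (h : 8 * (|b| * Z) ≤ S) :
    ∃ t, IsMultiplier V β t ∧ |t| ≤ 2 * |b| / S := by
  -- Twice the first-order root: at `±τ` the linear part `b - t * S` has a definite sign and size at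
  -- least `|b|`, enough to absorb the quadratic error, which `h` keeps below `|b|`.
  set τ := 2 * |b| / S with hτ
  have hτ0 : 0 ≤ τ := by positivity
  have hτZ : τ * Z ≤ 1 / 4 := by
    rw [hτ, div_mul_eq_mul_div, div_le_iff₀ hS0]
    linarith
  have hsmall : ∀ t, |t| ≤ τ → |t| * Z ≤ 1 / 4 ∨ n = 0 := by
    intro t ht
    rcases Nat.eq_zero_or_pos n with h0 | h0
    · exact Or.inr h0
    · have hZ0 : 0 ≤ Z := (abs_nonneg _).trans (hZ ⟨0, h0⟩)
      exact Or.inl ((mul_le_mul_of_nonneg_right ht hZ0).trans hτZ)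
  have hn : n ≠ 0 := by
    rintro rfl
    simp at hS
    linarith
  replace hsmall : ∀ t, |t| ≤ τ → |t| * Z ≤ 1 / 4 := fun t ht => (hsmall t ht).resolve_right hn
  have hpos : ∀ t, |t| ≤ τ → ∀ k, 0 < 1 + t * a k := by
    intro t ht k
    have h1 : |t * a k| ≤ 1 / 4 := by
      rw [abs_mul]
      exact (mul_le_mul_of_nonneg_left (hZ k) (abs_nonneg _)).trans (hsmall t ht)
    linarith [(abs_le.1 h1).1]
  set f : ℝ → ℝ := fun t => 1 / (n : ℝ) * ∑ k, a k / (1 + t * a k) with hf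
  have hcont : ContinuousOn f (Set.Icc (-τ) τ) := by
    refine continuousOn_const.mul (continuousOn_finsetSum _ fun k _ => ?_)
    refine continuousOn_const.div (by fun_prop) fun t ht => (hpos t (abs_le.2 ht) k).ne'
  have happ : ∀ t, |t| ≤ τ → |f t - (b - t * S)| ≤ 2 * t ^ 2 * Z * S := by
    intro t ht
    rw [hS, hb]
    exact abs_mean_div_sub_le hZ ((hsmall t ht).trans (by norm_num))
  have hquad : 2 * τ ^ 2 * Z * S ≤ |b| := by
    have e : 2 * τ ^ 2 * Z * S = |b| * (8 * (|b| * Z) / S) := by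
      rw [hτ]
      field_simp
      ring
    rw [e]
    exact mul_le_of_le_one_right (abs_nonneg _) ((div_le_one hS0).2 h)
  have hτS : τ * S = 2 * |b| := by rw [hτ]; field_simp
  have hup : f τ ≤ 0 := by
    have := (abs_le.1 (happ τ (abs_of_nonneg hτ0).le)).2
    linarith [le_abs_self b]
  have hdown : 0 ≤ f (-τ) := by
    have := (abs_le.1 (happ (-τ) (by rw [abs_neg, abs_of_nonneg hτ0]))).1
    rw [neg_sq] at this
    linarith [neg_abs_le b]
  obtain ⟨t, ht, h0⟩ := intermediate_value_Icc' (by linarith) hcont ⟨hup, hdown⟩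
  refine ⟨t, ⟨fun k => ?_, ?_⟩, abs_le.2 ht⟩
  · rw [← ha]
    exact hpos t (abs_le.2 ht) k
  · simp_rw [← ha]
    exact h0

theorem abs_log_one_add_sub_le {u : ℝ} (hu : |u| ≤ 1 / 2) :
    |Real.log (1 + u) - (u - u ^ 2 / 2)| ≤ 2 * |u| ^ 3 := by
  have h := Real.abs_log_sub_add_sum_range_le (x := -u) (by rw [abs_neg]; linarith) 2
  simp only [Finset.sum_range_succ, Finset.sum_range_zero, abs_neg] at h
  have e : Real.log (1 + u) - (u - u ^ 2 / 2)
      = 0 + (-u) ^ (0 + 1) / ((0 : ℕ) + 1 : ℝ) + (-u) ^ (1 + 1) / ((1 : ℕ) + 1 : ℝ)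
        + Real.log (1 - -u) := by
    rw [sub_neg_eq_add]
    norm_num
    ring
  rw [e]
  refine h.trans ?_
  rw [div_le_iff₀ (by linarith)]
  calc |u| ^ (2 + 1) = 2 * |u| ^ 3 * (1 / 2) := by ring
    _ ≤ 2 * |u| ^ 3 * (1 - |u|) := by gcongr; linarith

/-- The quadratic expansion of the empirical log-likelihood ratio. -/
theorem abs_neg_two_mul_logRatio_sub_le {a : Fin n → ℝ} {Z S b : ℝ} (ha : ∀ k, a k = V k - β)
    (hZ : ∀ k, |a k| ≤ Z) (hS : S = 1 / (n : ℝ) * ∑ k, a k ^ 2) (hb : b = 1 / (n : ℝ) * ∑ k, a k)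
    (hS0 : 0 < S) (h : 8 * (|b| * Z) ≤ S) :
    |-2 * logRatio V β - n * b ^ 2 / S| ≤ 40 * (n * b ^ 2 / S) * (|b| * Z / S) := by
  obtain ⟨t, htm, ht⟩ := exists_isMultiplier ha hZ hS hb hS0 h
  have hn : 0 < n := by
    rcases Nat.eq_zero_or_pos n with rfl | h0
    · simp at hS
      linarith
    · exact h0
  have hn' : (0 : ℝ) < n := by positivity
  have hZ0 : 0 ≤ Z := (abs_nonneg _).trans (hZ ⟨0, hn⟩)
  have htZ : |t| * Z ≤ 1 / 4 := by
    refine (mul_le_mul_of_nonneg_right ht hZ0).trans ?_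
    rw [div_mul_eq_mul_div, div_le_iff₀ hS0]
    linarith
  have hsumS : ∑ k, a k ^ 2 = n * S := by rw [hS]; field_simp
  have hsumb : ∑ k, a k = n * b := by rw [hb]; field_simp
  have hlog : |2 * ∑ k, Real.log (1 + t * a k) - (2 * t * (n * b) - t ^ 2 * (n * S))|
      ≤ 4 * |t| ^ 3 * Z * (n * S) := by
    rw [← hsumS, ← hsumb]
    have e : 2 * ∑ k, Real.log (1 + t * a k) - (2 * t * ∑ k, a k - t ^ 2 * ∑ k, a k ^ 2)
        = ∑ k, 2 * (Real.log (1 + t * a k) - (t * a k - (t * a k) ^ 2 / 2)) := by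
      simp only [Finset.mul_sum, ← Finset.sum_sub_distrib]
      refine Finset.sum_congr rfl fun k _ => ?_
      ring
    rw [e, Finset.mul_sum]
    refine (Finset.abs_sum_le_sum_abs _ _).trans (Finset.sum_le_sum fun k _ => ?_)
    have h1 : |t * a k| ≤ 1 / 2 := by
      rw [abs_mul]
      exact ((mul_le_mul_of_nonneg_left (hZ k) (abs_nonneg _)).trans htZ).trans (by norm_num)
    rw [abs_mul, abs_two]
    calc 2 * |Real.log (1 + t * a k) - (t * a k - (t * a k) ^ 2 / 2)|
        ≤ 2 * (2 * |t * a k| ^ 3) := by gcongr; exact abs_log_one_add_sub_le h1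
      _ = 4 * |t| ^ 3 * |a k| * a k ^ 2 := by
          rw [abs_mul, ← sq_abs (a k)]
          ring
      _ ≤ 4 * |t| ^ 3 * Z * a k ^ 2 := by gcongr; exact hZ k
  have ht2 : t ^ 2 ≤ (2 * |b| / S) ^ 2 := by
    rw [← sq_abs t]
    gcongr
  -- The estimating equation says `t = b / S` up to the error of the linearisation.
  have hfoc : |b - t * S| ≤ 8 * |b| * (|b| * Z / S) := by
    have := abs_mean_div_sub_le (t := t) hZ (htZ.trans (by norm_num))
    rw [← hS, ← hb] at this
    have h2 := htm.2
    simp_rw [← ha] at h2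
    rw [h2, zero_sub, abs_neg] at this
    refine this.trans ?_
    calc 2 * t ^ 2 * Z * S ≤ 2 * (2 * |b| / S) ^ 2 * Z * S := by gcongr
      _ = _ := by field_simp; ring
  have hρ : |b| * Z / S ≤ 1 / 8 := by
    rw [div_le_iff₀ hS0]
    linarith
  have hρ0 : 0 ≤ |b| * Z / S := by positivity
  set ρ := |b| * Z / S with hρdef
  have h3 : 4 * |t| ^ 3 * Z * (n * S) ≤ 32 * (n * b ^ 2 / S) * ρ := by
    calc 4 * |t| ^ 3 * Z * (n * S) ≤ 4 * (2 * |b| / S) ^ 3 * Z * (n * S) := by gcongr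
      _ = 32 * (n * |b| ^ 2 / S) * ρ := by rw [hρdef]; field_simp; ring
      _ = _ := by rw [sq_abs]
  -- This term is quadratic in `ρ`; one factor is spent through `8 * ρ ≤ 1`. The total constant is
  -- `32 + 8 = 40`.
  have h4 : n * (b - t * S) ^ 2 / S ≤ 8 * (n * b ^ 2 / S) * ρ := by
    calc n * (b - t * S) ^ 2 / S = n * |b - t * S| ^ 2 / S := by rw [sq_abs]
      _ ≤ n * (8 * |b| * ρ) ^ 2 / S := by gcongr
      _ = 8 * (n * |b| ^ 2 / S) * ρ * (8 * ρ) := by ring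
      _ ≤ 8 * (n * |b| ^ 2 / S) * ρ * 1 := by gcongr; linarith
      _ = _ := by rw [sq_abs, mul_one]
  rw [htm.logRatio_eq hn]
  simp_rw [← ha]
  -- Completing the square: `2 * t * b - t ^ 2 * S = b ^ 2 / S - (b - t * S) ^ 2 / S`.
  have e : -2 * -∑ k, Real.log (1 + t * a k) - n * b ^ 2 / S
      = (2 * ∑ k, Real.log (1 + t * a k) - (2 * t * (n * b) - t ^ 2 * (n * S)))
        - n * (b - t * S) ^ 2 / S := by
    field_simp
    ring
  rw [e]
  have h5 : 0 ≤ n * (b - t * S) ^ 2 / S := by positivity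
  have := abs_le.1 (hlog.trans h3)
  have hpos : 0 ≤ n * b ^ 2 / S * ρ := by positivity
  rw [abs_le]
  constructor <;> linarith

/-- This gives measurability of the log ratio even at samples without a multiplier. For `c > 0` the
supremum is attained on a compact feasible set, so the superlevel set is the projection, along the
compact simplex, of a closed set of pairs `(V, p)`. -/
theorem isClosed_setOf_le_empLik (β c : ℝ) :
    IsClosed {V : Fin n → ℝ | c ≤ empLik V β} := by
  have hnonneg : ∀ V : Fin n → ℝ, 0 ≤ empLik V β := fun V =>
    Real.sSup_nonneg fun _ ⟨p, hp, _, _, ht⟩ => ht ▸ Finset.prod_nonneg fun k _ => hp k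
  rcases le_or_gt c 0 with hc | hc
  · convert isClosed_univ
    exact Set.eq_univ_of_forall fun V => hc.trans (hnonneg V)
  have hK : IsCompact (stdSimplex ℝ (Fin n)) := isCompact_stdSimplex ℝ (Fin n)
  have hmax : ∀ V : Fin n → ℝ, c ≤ empLik V β →
      ∃ p ∈ stdSimplex ℝ (Fin n), ∑ k, p k * (V k - β) = 0 ∧ c ≤ ∏ k, p k := by
    intro V hV
    set C := stdSimplex ℝ (Fin n) ∩ {p | ∑ k, p k * (V k - β) = 0} with hC
    have hCc : IsCompact C := hK.inter_right (isClosed_eq (by fun_prop) continuous_const)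
    have hne : C.Nonempty := by
      by_contra hemp
      -- With no feasible weights the value is `sSup ∅ = 0`, which contradicts `0 < c ≤ empLik V β`.
      have : empLik V β = 0 := by
        rw [empLik]
        convert Real.sSup_empty
        refine Set.eq_empty_of_forall_notMem ?_
        rintro _ ⟨p, hp, hp1, hpV, rfl⟩
        exact hemp ⟨p, ⟨hp, hp1⟩, hpV⟩
      linarith
    obtain ⟨p, hp, hpmax⟩ := hCc.exists_isMaxOn hne
      (f := fun p : Fin n → ℝ => ∏ k, p k) (by fun_prop)
    refine ⟨p, hp.1, hp.2, hV.trans (csSup_le ⟨_, p, hp.1.1, hp.1.2, hp.2, rfl⟩ ?_)⟩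
    rintro _ ⟨q, hq, hq1, hqV, rfl⟩
    exact hpmax ⟨⟨hq, hq1⟩, hqV⟩
  set D : Set ((Fin n → ℝ) × stdSimplex ℝ (Fin n)) :=
    {x | ∑ k, x.2.1 k * (x.1 k - β) = 0 ∧ c ≤ ∏ k, x.2.1 k} with hD
  have hDc : IsClosed D := by
    have hp : ∀ k, Continuous fun x : (Fin n → ℝ) × stdSimplex ℝ (Fin n) => x.2.1 k := fun k =>
      (continuous_apply k).comp (continuous_subtype_val.comp continuous_snd)
    exact (isClosed_eq (by fun_prop) continuous_const).and
      (isClosed_le continuous_const (by fun_prop))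
  have : CompactSpace (stdSimplex ℝ (Fin n)) := isCompact_iff_compactSpace.1 hK
  have himg := isClosedMap_fst_of_compactSpace (X := Fin n → ℝ) (Y := stdSimplex ℝ (Fin n)) D hDc
  convert himg
  ext V
  simp only [Set.mem_ofPred_eq, Set.mem_image, Prod.exists, exists_and_right, exists_eq_right]
  constructor
  · intro hV
    obtain ⟨p, hp, h1, h2⟩ := hmax V hV
    exact ⟨⟨p, hp⟩, h1, h2⟩
  · rintro ⟨⟨p, hp⟩, h1, h2⟩
    refine h2.trans (le_csSup ⟨1, ?_⟩ ⟨p, hp.1, hp.2, h1, rfl⟩)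
    rintro _ ⟨q, hq, hq1, -, rfl⟩
    refine Finset.prod_le_one (fun k _ => hq k) fun k _ => ?_
    rw [← hq1]
    exact Finset.single_le_sum (fun i _ => hq i) (Finset.mem_univ k)

theorem measurable_logRatio (β : ℝ) : Measurable fun V : Fin n → ℝ => logRatio V β := by
  have : Measurable fun V : Fin n → ℝ => empLik V β :=
    measurable_of_Ici fun c => (isClosed_setOf_le_empLik β c).measurableSet
  exact Real.measurable_log.comp (this.div_const _)

end EmpiricalLikelihood

/-! ### U-statistics: counting, second moments, jackknife identities. -/

section UStatistic

/-- The average of `h A` over the subsets `A` of `s` with `m` elements. -/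
noncomputable def uStat (m : ℕ) (h : Finset ℕ → ℝ) (s : Finset ℕ) : ℝ :=
  1 / (s.card.choose m : ℝ) * ∑ A ∈ s.powersetCard m, h A

theorem uStat_sub (m : ℕ) (h h' : Finset ℕ → ℝ) (s : Finset ℕ) :
    uStat m (fun A => h A - h' A) s = uStat m h s - uStat m h' s := by
  simp only [uStat, Finset.sum_sub_distrib, mul_sub]

theorem uStat_const {m : ℕ} {s : Finset ℕ} (hm : m ≤ s.card) (c : ℝ) :
    uStat m (fun _ => c) s = c := by
  have : (s.card.choose m : ℝ) ≠ 0 := by exact_mod_cast (Nat.choose_pos hm).ne'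
  rw [uStat, Finset.sum_const, Finset.card_powersetCard, nsmul_eq_mul]
  field_simp

theorem betaHat_eq_uStat (r : ℕ) (x : ℕ → ℝ) (s : Finset ℕ) :
    betaHat r x s = 1 / ((r : ℝ) + 1) * uStat (r + 1) (fun A => maxKernel fun i : A => x i) s := by
  rw [betaHat, uStat, mul_assoc]

/-- Double counting: `A` and `B` with at least `j` common elements share a subset `J` of size `j`,
and each `J` lies in `(s.card - j).choose (m - j)` sets of size `m`. -/
theorem sum_card_inter_le {m j : ℕ} (hj : j ≤ m) (s : Finset ℕ) :
    ∑ A ∈ s.powersetCard m, ∑ B ∈ s.powersetCard m, (if j ≤ (A ∩ B).card then 1 else 0 : ℕ)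
      ≤ s.card.choose j * (s.card - j).choose (m - j) ^ 2 := by
  classical
  calc _ ≤ ∑ A ∈ s.powersetCard m, ∑ B ∈ s.powersetCard m, ∑ J ∈ s.powersetCard j,
        (if J ⊆ A then 1 else 0) * (if J ⊆ B then 1 else 0) := by
        refine Finset.sum_le_sum fun A hA => Finset.sum_le_sum fun B _ => ?_
        split_ifs with h
        · obtain ⟨J, hJ, hJc⟩ := Finset.exists_subset_card_eq h
          have hJA := hJ.trans Finset.inter_subset_left
          have hJB := hJ.trans Finset.inter_subset_right
          have hJs : J ∈ s.powersetCard j :=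
            Finset.mem_powersetCard.2 ⟨hJA.trans (Finset.mem_powersetCard.1 hA).1, hJc⟩
          refine le_trans ?_ (Finset.single_le_sum (fun _ _ => Nat.zero_le _) hJs)
          simp [hJA, hJB]
        · exact Nat.zero_le _
    _ = ∑ J ∈ s.powersetCard j, (∑ A ∈ s.powersetCard m, if J ⊆ A then 1 else 0) ^ 2 := by
        simp_rw [sq, Finset.sum_mul_sum]
        rw [Finset.sum_comm, Finset.sum_congr rfl fun A _ => Finset.sum_comm, Finset.sum_comm]
        refine Finset.sum_congr rfl fun J _ => Finset.sum_comm
    _ = ∑ J ∈ s.powersetCard j, (s.card - j).choose (m - j) ^ 2 := by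
        refine Finset.sum_congr rfl fun J hJ => ?_
        obtain ⟨hJs, hJc⟩ := Finset.mem_powersetCard.1 hJ
        rw [← Finset.card_filter,
          Finset.card_filter_powersetCard_subset J s m hJs (hJc.trans_le hj), hJc]
    _ = _ := by simp

/-- After expanding the square, pairs with fewer than `j` common indices vanish and the others
contribute at most `C`, by `2xy ≤ x² + y²`. The bound has order `s.card ^ (-j)`: it is used with `j
= 1` for centred kernels and `j = 2` for degenerate ones. -/
theorem integral_uStat_sq_le {Ω : Type*} [MeasurableSpace Ω] {μ : Measure Ω} {m j : ℕ}
    (hj : j ≤ m) {s : Finset ℕ} (hm : m ≤ s.card) {Y : Finset ℕ → Ω → ℝ} {C : ℝ} (hC0 : 0 ≤ C)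
    (hL : ∀ A ∈ s.powersetCard m, MemLp (Y A) 2 μ)
    (hC : ∀ A ∈ s.powersetCard m, ∫ ω, Y A ω ^ 2 ∂μ ≤ C)
    (h0 : ∀ A ∈ s.powersetCard m, ∀ B ∈ s.powersetCard m, (A ∩ B).card < j →
      ∫ ω, Y A ω * Y B ω ∂μ = 0) :
    ∫ ω, uStat m (fun A => Y A ω) s ^ 2 ∂μ
      ≤ C * ((m.choose j : ℝ) ^ 2 / (s.card.choose j : ℝ)) := by
  have hc : (0 : ℝ) < s.card.choose m := by exact_mod_cast Nat.choose_pos hm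
  have hcj : (0 : ℝ) < s.card.choose j := by exact_mod_cast Nat.choose_pos (hj.trans hm)
  have hint : ∀ A ∈ s.powersetCard m, ∀ B ∈ s.powersetCard m,
      Integrable (fun ω => Y A ω * Y B ω) μ := fun A hA B hB => (hL A hA).integrable_mul (hL B hB)
  have hle : ∀ A ∈ s.powersetCard m, ∀ B ∈ s.powersetCard m,
      ∫ ω, Y A ω * Y B ω ∂μ ≤ C * (if j ≤ (A ∩ B).card then 1 else 0 : ℕ) := by
    intro A hA B hB
    split_ifs with h
    · have h1 : ∫ ω, Y A ω * Y B ω ∂μ ≤ ∫ ω, (1 / 2 * Y A ω ^ 2 + 1 / 2 * Y B ω ^ 2) ∂μ := by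
        refine integral_mono (hint A hA B hB) (((hL A hA).integrable_sq.const_mul _).add
          ((hL B hB).integrable_sq.const_mul _)) fun ω => ?_
        simp only
        nlinarith [sq_nonneg (Y A ω - Y B ω)]
      rw [integral_add ((hL A hA).integrable_sq.const_mul _)
        ((hL B hB).integrable_sq.const_mul _), integral_const_mul, integral_const_mul] at h1
      have := hC A hA
      have := hC B hB
      push_cast
      linarith
    · rw [h0 A hA B hB (not_le.1 h)]
      simp
  have hcount : (∑ A ∈ s.powersetCard m, ∑ B ∈ s.powersetCard m,
      ((if j ≤ (A ∩ B).card then 1 else 0 : ℕ) : ℝ))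
      ≤ s.card.choose j * ((s.card - j).choose (m - j) : ℝ) ^ 2 := by
    exact_mod_cast sum_card_inter_le hj s
  have hchoose : (s.card.choose m : ℝ) * m.choose j
      = s.card.choose j * (s.card - j).choose (m - j) := by
    exact_mod_cast Nat.choose_mul hj
  have e : ∀ ω, uStat m (fun A => Y A ω) s ^ 2 = 1 / (s.card.choose m : ℝ) ^ 2 *
      ∑ A ∈ s.powersetCard m, ∑ B ∈ s.powersetCard m, Y A ω * Y B ω := by
    intro ω
    rw [uStat, mul_pow, sq (∑ A ∈ _, _), Finset.sum_mul_sum, div_pow, one_pow]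
  simp_rw [e]
  rw [integral_const_mul, integral_finsetSum _ fun A hA =>
    integrable_finsetSum _ fun B hB => hint A hA B hB]
  calc 1 / (s.card.choose m : ℝ) ^ 2 * ∑ A ∈ s.powersetCard m,
        ∫ ω, ∑ B ∈ s.powersetCard m, Y A ω * Y B ω ∂μ
      ≤ 1 / (s.card.choose m : ℝ) ^ 2 * ∑ A ∈ s.powersetCard m,
        ∑ B ∈ s.powersetCard m, C * (if j ≤ (A ∩ B).card then 1 else 0 : ℕ) := by
        gcongr with A hA
        rw [integral_finsetSum _ fun B hB => hint A hA B hB]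
        exact Finset.sum_le_sum fun B hB => hle A hA B hB
    _ ≤ 1 / (s.card.choose m : ℝ) ^ 2 *
        (C * (s.card.choose j * ((s.card - j).choose (m - j) : ℝ) ^ 2)) := by
        simp_rw [← Finset.mul_sum]
        gcongr
    _ = _ := by
        have h2 : ((s.card - j).choose (m - j) : ℝ)
            = s.card.choose m * m.choose j / s.card.choose j := by
          rw [hchoose]
          field_simp
        rw [h2]
        field_simp

/-- Each index lies in `(s.card - 1).choose (m - 1)` of the subsets. This identifies the linear part
of a U-statistic with a multiple of a sample mean. -/
theorem uStat_sum (g : ℕ → ℝ) {m : ℕ} (hm0 : 1 ≤ m) {s : Finset ℕ} (hm : m ≤ s.card) :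
    uStat m (fun A => ∑ i ∈ A, g i) s = (m : ℝ) / s.card * ∑ i ∈ s, g i := by
  classical
  have h1 : ∑ A ∈ s.powersetCard m, ∑ i ∈ A, g i
      = ∑ i ∈ s, ((s.card - 1).choose (m - 1) : ℝ) * g i := by
    rw [Finset.sum_comm' (t' := s) (s' := fun i => (s.powersetCard m).filter ({i} ⊆ ·))]
    · refine Finset.sum_congr rfl fun i hi => ?_
      rw [Finset.sum_const, nsmul_eq_mul, Finset.card_filter_powersetCard_subset {i} s m
        (Finset.singleton_subset_iff.2 hi) (by simpa using hm0), Finset.card_singleton]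
    · intro A i
      simp only [Finset.mem_powersetCard, Finset.mem_filter, Finset.singleton_subset_iff]
      exact ⟨fun ⟨h, hi⟩ => ⟨⟨h, hi⟩, h.1 hi⟩, fun ⟨⟨h, hi⟩, _⟩ => ⟨h, hi⟩⟩
  have hc : (0 : ℝ) < s.card.choose m := by exact_mod_cast Nat.choose_pos hm
  have hs : (0 : ℝ) < s.card := by exact_mod_cast (hm0.trans hm)
  have h2 : (s.card : ℝ) * (s.card - 1).choose (m - 1) = s.card.choose m * m := by
    have := Nat.add_one_mul_choose_eq (s.card - 1) (m - 1)
    rw [Nat.sub_add_cancel (hm0.trans hm), Nat.sub_add_cancel hm0] at this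
    exact_mod_cast this
  rw [uStat, h1, ← Finset.mul_sum, ← mul_assoc]
  congr 1
  rw [one_div_mul_eq_div, div_eq_div_iff hc.ne' hs.ne']
  linarith

/-- Each `A` survives the deletion of exactly `s.card - m` indices. Hence the pseudo-values average
to the original estimator. -/
theorem sum_uStat_erase (h : Finset ℕ → ℝ) {m : ℕ} {s : Finset ℕ} (hm : m < s.card) :
    ∑ k ∈ s, uStat m h (s.erase k) = s.card * uStat m h s := by
  classical
  have hcard : ∀ k ∈ s, (s.erase k).card = s.card - 1 := fun k hk => Finset.card_erase_of_mem hk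
  have h1 : ∑ k ∈ s, ∑ A ∈ (s.erase k).powersetCard m, h A
      = ∑ A ∈ s.powersetCard m, ((s.card : ℝ) - m) * h A := by
    rw [Finset.sum_comm' (t' := s.powersetCard m) (s' := fun A => s \ A)]
    · refine Finset.sum_congr rfl fun A hA => ?_
      obtain ⟨hAs, hAc⟩ := Finset.mem_powersetCard.1 hA
      rw [Finset.sum_const, nsmul_eq_mul, Finset.card_sdiff_of_subset hAs, hAc,
        Nat.cast_sub hm.le]
    · intro k A
      simp only [Finset.mem_powersetCard, Finset.mem_sdiff, Finset.subset_erase]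
      tauto
  have hc : (0 : ℝ) < s.card.choose m := by exact_mod_cast Nat.choose_pos hm.le
  have hc' : (0 : ℝ) < (s.card - 1).choose m := by exact_mod_cast Nat.choose_pos (by omega)
  have h2 : ((s.card : ℝ) - m) * s.card.choose m = s.card * (s.card - 1).choose m := by
    have := Nat.choose_mul_succ_eq (s.card - 1) m
    rw [Nat.sub_add_cancel (by omega)] at this
    rw [← Nat.cast_sub hm.le, mul_comm, mul_comm (s.card : ℝ)]
    exact_mod_cast this.symm
  calc ∑ k ∈ s, uStat m h (s.erase k)
      = ∑ k ∈ s, 1 / ((s.card - 1).choose m : ℝ) * ∑ A ∈ (s.erase k).powersetCard m, h A :=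
        Finset.sum_congr rfl fun k hk => by rw [uStat, hcard k hk]
    _ = 1 / ((s.card - 1).choose m : ℝ) * (((s.card : ℝ) - m) *
        ∑ A ∈ s.powersetCard m, h A) := by rw [← Finset.mul_sum, h1, ← Finset.mul_sum]
    _ = _ := by
        rw [uStat, ← mul_assoc, ← mul_assoc]
        congr 1
        field_simp
        linarith

/-- Splitting the subsets by whether they contain `k` removes the large factors: an average over
sets containing `k`, which carries the dependence on observation `k`, is left next to one that
avoids it. -/
theorem pseudoValue_eq (h : Finset ℕ → ℝ) {r : ℕ} {s : Finset ℕ} (hs : r + 2 ≤ s.card) {k : ℕ}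
    (hk : k ∈ s) :
    (s.card : ℝ) * (1 / ((r : ℝ) + 1) * uStat (r + 1) h s)
        - ((s.card : ℝ) - 1) * (1 / ((r : ℝ) + 1) * uStat (r + 1) h (s.erase k))
      = uStat r (fun B => h (insert k B)) (s.erase k)
        - (r : ℝ) / (r + 1) * uStat (r + 1) h (s.erase k) := by
  classical
  have hkn : k ∉ s.erase k := Finset.notMem_erase k s
  -- Writing the size with `d` avoids truncated subtraction; all binomial coefficients become
  -- multiples of `(r + 1 + d).choose r`.
  obtain ⟨d, hd⟩ : ∃ d, (s.erase k).card = r + 1 + d :=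
    ⟨(s.erase k).card - (r + 1), by rw [Finset.card_erase_of_mem hk]; omega⟩
  have hsc : s.card = r + 1 + d + 1 := by
    rw [← hd, Finset.card_erase_add_one hk]
  have hsum : ∑ A ∈ s.powersetCard (r + 1), h A = ∑ A ∈ (s.erase k).powersetCard (r + 1), h A
      + ∑ B ∈ (s.erase k).powersetCard r, h (insert k B) := by
    conv_lhs => rw [← Finset.insert_erase hk, Finset.powersetCard_succ_insert hkn]
    rw [Finset.sum_union, Finset.sum_image]
    · intro B hB B' hB' he
      have h1 : k ∉ B := fun hm => hkn ((Finset.mem_powersetCard.1 hB).1 hm)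
      have h2 : k ∉ B' := fun hm => hkn ((Finset.mem_powersetCard.1 hB').1 hm)
      rw [← Finset.erase_insert h1, ← Finset.erase_insert h2]
      exact congrArg (Finset.erase · k) he
    · rw [Finset.disjoint_left]
      intro A hA hA'
      obtain ⟨B, -, rfl⟩ := Finset.mem_image.1 hA'
      exact hkn ((Finset.mem_powersetCard.1 hA).1 (Finset.mem_insert_self k B))
  have hc0 : (0 : ℝ) < (r + 1 + d).choose r := by exact_mod_cast Nat.choose_pos (by omega)
  have hc1 : ((r + 1 + d).choose (r + 1) : ℝ) = (r + 1 + d).choose r * (1 + d) / (r + 1) := by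
    have := Nat.choose_succ_right_eq (r + 1 + d) r
    rw [show r + 1 + d - r = 1 + d by omega] at this
    rw [eq_div_iff (by positivity)]
    exact_mod_cast this
  have hc : ((r + 1 + d + 1).choose (r + 1) : ℝ)
      = (r + 1 + d).choose r * (r + 2 + d) / (r + 1) := by
    rw [Nat.choose_succ_succ, Nat.cast_add, Nat.succ_eq_add_one, hc1]
    field_simp
    ring
  rw [uStat, uStat, uStat, hsum, hsc, hd, hc, hc1]
  push_cast
  field_simp
  ring

end UStatistic

/-! ### The maximum of two independent variables. -/

section MaxMean

/-- The expectation of `max x Y` for a random variable `Y` with law `ν`. -/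
noncomputable def maxMean (ν : Measure ℝ) (x : ℝ) : ℝ :=
  ∫ y, max x y ∂ν

variable {P ν : Measure ℝ} [IsProbabilityMeasure P] [IsProbabilityMeasure ν]

theorem measurable_maxMean {ν : Measure ℝ} [SFinite ν] : Measurable (maxMean ν) := by
  have : StronglyMeasurable fun p : ℝ × ℝ => max p.1 p.2 :=
    (measurable_fst.max measurable_snd).stronglyMeasurable
  exact this.integral_prod_right.measurable

/-- Fubini gives integrability for almost every `x`. As the maximum is 1-Lipschitz in `x`, one good
point suffices for all. -/
theorem integrable_max_right (hL : MemLp (fun p : ℝ × ℝ => max p.1 p.2) 2 (P.prod ν)) (x : ℝ) :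
    Integrable (fun y => max x y) ν := by
  have hint : Integrable (fun p : ℝ × ℝ => max p.1 p.2) (P.prod ν) := hL.integrable one_le_two
  obtain ⟨x', hx'⟩ := hint.prod_right_ae.exists
  refine (hx'.norm.add (integrable_const |x - x'|)).mono' (by fun_prop) (ae_of_all _ fun y => ?_)
  have := abs_max_sub_max_le_abs x x' y
  simp only [Pi.add_apply, Real.norm_eq_abs]
  calc |max x y| = |max x' y + (max x y - max x' y)| := by ring_nf
    _ ≤ _ := (abs_add_le _ _).trans (by gcongr)

theorem integral_maxMean (hL : MemLp (fun p : ℝ × ℝ => max p.1 p.2) 2 (P.prod ν)) :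
    ∫ x, maxMean ν x ∂P = ∫ p : ℝ × ℝ, max p.1 p.2 ∂(P.prod ν) :=
  (integral_prod _ (hL.integrable one_le_two)).symm

/-- Jensen's inequality, in the form of a nonnegative variance of the section at `x`. -/
theorem memLp_maxMean (hL : MemLp (fun p : ℝ × ℝ => max p.1 p.2) 2 (P.prod ν)) :
    MemLp (maxMean ν) 2 P := by
  rw [memLp_two_iff_integrable_sq measurable_maxMean.aestronglyMeasurable]
  have hint := hL.integrable_sq
  refine hint.integral_prod_left.mono' (measurable_maxMean.pow_const 2).aestronglyMeasurable ?_
  filter_upwards [hint.prod_right_ae] with x hx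
  have hLx : MemLp (fun y => max x y) 2 ν :=
    (memLp_two_iff_integrable_sq (by fun_prop)).2 hx
  have h1 := variance_nonneg (fun y => max x y) ν
  rw [variance_eq_sub hLx] at h1
  rw [Real.norm_eq_abs, abs_of_nonneg (sq_nonneg _), maxMean]
  simp only [Pi.pow_apply] at h1
  linarith

/-- `max x Y - E[max x Y]` is uncorrelated with all functions independent of `Y`. -/
theorem integral_max_sub_maxMean_mul {Ω : Type*} [MeasurableSpace Ω] {μ : Measure Ω}
    [IsProbabilityMeasure μ] (hL : MemLp (fun p : ℝ × ℝ => max p.1 p.2) 2 (P.prod ν))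
    {ξ U Z : Ω → ℝ} (hξ : Measurable ξ) (hU : Measurable U) (hZ : Measurable Z)
    (hlaw : μ.map ξ = ν) (hind : IndepFun ξ (fun ω => (U ω, Z ω)) μ) :
    ∫ ω, (max (U ω) (ξ ω) - maxMean ν (U ω)) * Z ω ∂μ = 0 := by
  have hUZ : Measurable fun ω => (U ω, Z ω) := hU.prodMk hZ
  have hjoint := (indepFun_iff_map_prod_eq_prod_map_map hξ.aemeasurable hUZ.aemeasurable).1 hind
  have := measurable_maxMean (ν := ν)
  have hF : Measurable fun q : ℝ × (ℝ × ℝ) => (max q.2.1 q.1 - maxMean ν q.2.1) * q.2.2 := by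
    fun_prop
  have : IsProbabilityMeasure (μ.map fun ω => (U ω, Z ω)) :=
    Measure.isProbabilityMeasure_map hUZ.aemeasurable
  calc ∫ ω, (max (U ω) (ξ ω) - maxMean ν (U ω)) * Z ω ∂μ
      = ∫ q, (max q.2.1 q.1 - maxMean ν q.2.1) * q.2.2 ∂(μ.map fun ω => (ξ ω, U ω, Z ω)) := by
        rw [integral_map (hξ.prodMk hUZ).aemeasurable hF.aestronglyMeasurable]
    _ = 0 := by
        rw [hjoint, hlaw]
        -- Without integrability the Bochner integral is `0` by convention, so no moment of `Z` has
        -- to be assumed.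
        by_cases hi : Integrable (fun q : ℝ × (ℝ × ℝ) => (max q.2.1 q.1 - maxMean ν q.2.1) * q.2.2)
            (ν.prod (μ.map fun ω => (U ω, Z ω)))
        · rw [integral_prod_symm _ hi]
          refine integral_eq_zero_of_ae (ae_of_all _ fun z => ?_)
          simp only [Pi.zero_apply]
          rw [integral_mul_const, integral_sub (integrable_max_right hL z.1) (integrable_const _)]
          simp [maxMean]
        · exact integral_undef hi

end MaxMean

/-! ### Maxima over index sets: laws and independence. -/

section SubMax

/-- The maximum of the variables `X i`, `i ∈ A`. -/
noncomputable def subMax {Ω : Type*} (X : ℕ → Ω → ℝ) (A : Finset ℕ) (ω : Ω) : ℝ :=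
  maxKernel fun i : A => X i ω

theorem maxKernel_le_iff {ι : Type*} [Fintype ι] [Nonempty ι] {v : ι → ℝ} {c : ℝ} :
    maxKernel v ≤ c ↔ ∀ i, v i ≤ c :=
  ciSup_le_iff (Set.finite_range v).bddAbove

theorem le_maxKernel {ι : Type*} [Fintype ι] (v : ι → ℝ) (i : ι) : v i ≤ maxKernel v :=
  le_ciSup (Set.finite_range v).bddAbove i

theorem subMax_le_iff {Ω : Type*} {X : ℕ → Ω → ℝ} {A : Finset ℕ} (hA : A.Nonempty) {ω : Ω}
    {c : ℝ} : subMax X A ω ≤ c ↔ ∀ i ∈ A, X i ω ≤ c := by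
  have : Nonempty A := hA.to_subtype
  rw [subMax, maxKernel_le_iff]
  simp

theorem subMax_insert {Ω : Type*} {X : ℕ → Ω → ℝ} {B : Finset ℕ} (hB : B.Nonempty) (k : ℕ)
    (ω : Ω) : subMax X (insert k B) ω = max (X k ω) (subMax X B ω) := by
  refine eq_of_forall_ge_iff fun c => ?_
  rw [subMax_le_iff (Finset.insert_nonempty k B), max_le_iff, subMax_le_iff hB,
    Finset.forall_mem_insert]

theorem maxKernel_fin_eq {Ω : Type*} (X : ℕ → Ω → ℝ) (r : ℕ) (ω : Ω) :
    maxKernel (fun j : Fin (r + 1) => X j ω) = subMax X (Finset.range (r + 1)) ω := by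
  refine eq_of_forall_ge_iff fun c => ?_
  rw [subMax_le_iff (by simp), maxKernel_le_iff, Fin.forall_iff]
  simp

theorem measurable_maxKernel {Ω ι : Type*} [MeasurableSpace Ω] [Fintype ι] [Nonempty ι]
    {Y : ι → Ω → ℝ} (hY : ∀ i, Measurable (Y i)) :
    Measurable fun ω => maxKernel fun i => Y i ω := by
  refine measurable_of_Iic fun c => ?_
  have : (fun ω => maxKernel fun i => Y i ω) ⁻¹' Set.Iic c = ⋂ i, Y i ⁻¹' Set.Iic c := by
    ext ω
    simp [maxKernel_le_iff]
  rw [this]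
  exact MeasurableSet.iInter fun i => hY i measurableSet_Iic

theorem measurable_subMax {Ω : Type*} {m : MeasurableSpace Ω} {X : ℕ → Ω → ℝ} {A : Finset ℕ}
    (hA : A.Nonempty) (hX : ∀ i ∈ A, Measurable (X i)) : Measurable (subMax X A) := by
  have : Nonempty A := hA.to_subtype
  exact measurable_maxKernel fun i : A => hX i i.2

theorem measurable_subMax_sub_sum {Ω : Type*} {m : MeasurableSpace Ω} {X : ℕ → Ω → ℝ}
    {A : Finset ℕ} (hA : A.Nonempty) (hX : ∀ i ∈ A, Measurable (X i)) (c : ℝ) {g : ℝ → ℝ}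
    (hg : Measurable g) : Measurable fun ω => subMax X A ω - c - ∑ i ∈ A, g (X i ω) :=
  ((measurable_subMax hA hX).sub_const _).sub
    (Finset.measurable_sum _ fun i hi => hg.comp (hX i hi))

/-- The σ-algebra generated by the variables `X i`, `i ∈ S`. -/
@[reducible] def sigmaOf {Ω : Type*} (X : ℕ → Ω → ℝ) (S : Set ℕ) : MeasurableSpace Ω :=
  ⨆ i ∈ S, MeasurableSpace.comap (X i) inferInstance

variable {Ω : Type*} {X : ℕ → Ω → ℝ}

theorem measurable_sigmaOf {S : Set ℕ} {i : ℕ} (hi : i ∈ S) : Measurable[sigmaOf X S] (X i) :=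
  (comap_measurable (X i)).mono (le_biSup (fun i => MeasurableSpace.comap (X i) inferInstance) hi)
    le_rfl

theorem measurable_subMax_sigmaOf {S : Set ℕ} {A : Finset ℕ} (hA : A.Nonempty)
    (hAS : ∀ i ∈ A, i ∈ S) : Measurable[sigmaOf X S] (subMax X A) :=
  measurable_subMax hA fun i hi => measurable_sigmaOf (hAS i hi)

variable [MeasurableSpace Ω] {μ : Measure Ω}

theorem indepFun_of_sigmaOf (hmeas : ∀ i, Measurable (X i)) (hindep : iIndepFun X μ)
    {E F : Type*} [MeasurableSpace E] [MeasurableSpace F] {S T : Set ℕ} (hST : Disjoint S T)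
    {f : Ω → E} {g : Ω → F} (hf : Measurable[sigmaOf X S] f) (hg : Measurable[sigmaOf X T] g) :
    IndepFun f g μ := by
  have h := indep_iSup_of_disjoint (fun i => (hmeas i).comap_le) hindep.iIndep hST
  rw [IndepFun_iff_Indep]
  exact indep_of_indep_of_le_left (indep_of_indep_of_le_right h hg.comap_le) hf.comap_le

theorem map_subMax_Iic (hmeas : ∀ i, Measurable (X i)) (hindep : iIndepFun X μ)
    (hident : ∀ i, IdentDistrib (X i) (X 0) μ μ) {A : Finset ℕ} (hA : A.Nonempty) (x : ℝ) :
    μ.map (subMax X A) (Set.Iic x) = (μ.map (X 0) (Set.Iic x)) ^ A.card := by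
  rw [Measure.map_apply (measurable_subMax hA fun i _ => hmeas i) measurableSet_Iic]
  have : subMax X A ⁻¹' Set.Iic x = ⋂ i ∈ A, X i ⁻¹' Set.Iic x := by
    ext ω
    simp [subMax_le_iff hA]
  rw [this, hindep.measure_inter_preimage_eq_mul A fun _ _ => measurableSet_Iic,
    Finset.prod_congr rfl fun i _ => (?_ : _ = μ.map (X 0) (Set.Iic x)), Finset.prod_const]
  rw [← (hident i).map_eq, Measure.map_apply (hmeas i) measurableSet_Iic]

variable [IsProbabilityMeasure μ]

theorem map_subMax_eq (hmeas : ∀ i, Measurable (X i)) (hindep : iIndepFun X μ)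
    (hident : ∀ i, IdentDistrib (X i) (X 0) μ μ) {A B : Finset ℕ} (hA : A.Nonempty)
    (hAB : A.card = B.card) : μ.map (subMax X A) = μ.map (subMax X B) := by
  have hB : B.Nonempty := Finset.card_pos.1 (hAB ▸ Finset.card_pos.2 hA)
  have := Measure.isProbabilityMeasure_map (μ := μ)
    (measurable_subMax hA fun i _ => hmeas i).aemeasurable
  have := Measure.isProbabilityMeasure_map (μ := μ)
    (measurable_subMax hB fun i _ => hmeas i).aemeasurable
  refine Measure.ext_of_Iic _ _ fun x => ?_
  rw [map_subMax_Iic hmeas hindep hident hA, map_subMax_Iic hmeas hindep hident hB, hAB]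

/-- This factorisation reduces moments of the kernel to the maximum of two independent variables
with fixed laws. -/
theorem map_prodMk_subMax (hmeas : ∀ i, Measurable (X i)) (hindep : iIndepFun X μ)
    (hident : ∀ i, IdentDistrib (X i) (X 0) μ μ) {r : ℕ} (hr : 1 ≤ r) {k : ℕ} {B : Finset ℕ}
    (hk : k ∉ B) (hB : B.card = r) :
    μ.map (fun ω => (X k ω, subMax X B ω))
      = (μ.map (X 0)).prod (μ.map (subMax X (Finset.range r))) := by
  have hBn : B.Nonempty := Finset.card_pos.1 (by omega)
  have hind : IndepFun (X k) (subMax X B) μ := by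
    refine indepFun_of_sigmaOf hmeas hindep (S := {k}) (T := B) (by simpa using hk)
      (measurable_sigmaOf rfl) (measurable_subMax_sigmaOf hBn fun i hi => hi)
  rw [(indepFun_iff_map_prod_eq_prod_map_map (hmeas k).aemeasurable
    (measurable_subMax hBn fun i _ => hmeas i).aemeasurable).1 hind, (hident k).map_eq,
    map_subMax_eq hmeas hindep hident hBn (B := Finset.range r) (by simpa using hB)]

end SubMax

/-! ### Second-moment bounds for the maximum kernel. -/

section Moments

variable {Ω : Type*} [MeasurableSpace Ω]

/-- A sequence of independent copies of a random variable such that the maximum of `r + 1` of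
them is square integrable. -/
structure IsMaxSample (μ : Measure Ω) (X : ℕ → Ω → ℝ) (r : ℕ) : Prop where
  measurable : ∀ i, Measurable (X i)
  indep : iIndepFun X μ
  ident : ∀ i, IdentDistrib (X i) (X 0) μ μ
  one_le : 1 ≤ r
  memLp : MemLp (subMax X (Finset.range (r + 1))) 2 μ

/-- The law of the maximum of `r` of the variables. -/
noncomputable abbrev restLaw (μ : Measure Ω) (X : ℕ → Ω → ℝ) (r : ℕ) : Measure ℝ :=
  μ.map (subMax X (Finset.range r))

/-- The expectation of the maximum of `r + 1` of the variables. -/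
noncomputable def meanMax (μ : Measure Ω) (X : ℕ → Ω → ℝ) (r : ℕ) : ℝ :=
  ∫ x, maxMean (restLaw μ X r) x ∂(μ.map (X 0))

/-- The centred first-order projection of the maximum of `r + 1` of the variables. -/
noncomputable def proj (μ : Measure Ω) (X : ℕ → Ω → ℝ) (r : ℕ) (x : ℝ) : ℝ :=
  maxMean (restLaw μ X r) x - meanMax μ X r

variable {μ : Measure Ω} {X : ℕ → Ω → ℝ} {r : ℕ}

theorem measurable_proj [SFinite μ] : Measurable (proj μ X r) :=
  measurable_maxMean.sub_const _

namespace IsMaxSample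

theorem nonempty_of_card (S : IsMaxSample μ X r) {A : Finset ℕ} (hA : r ≤ A.card) :
    A.Nonempty :=
  Finset.card_pos.1 (S.one_le.trans hA)

theorem measurable_subMax (S : IsMaxSample μ X r) {A : Finset ℕ} (hA : A.Nonempty) :
    Measurable (subMax X A) :=
  JEL.measurable_subMax hA fun i _ => S.measurable i

theorem measurable_prodMk (S : IsMaxSample μ X r) {B : Finset ℕ} (hB : B.card = r) (k : ℕ) :
    Measurable fun ω => (X k ω, subMax X B ω) :=
  (S.measurable k).prodMk (S.measurable_subMax (S.nonempty_of_card hB.ge))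

variable [IsProbabilityMeasure μ]

theorem isProbabilityMeasure_law (S : IsMaxSample μ X r) : IsProbabilityMeasure (μ.map (X 0)) :=
  Measure.isProbabilityMeasure_map (S.measurable 0).aemeasurable

theorem isProbabilityMeasure_restLaw (S : IsMaxSample μ X r) :
    IsProbabilityMeasure (restLaw μ X r) :=
  Measure.isProbabilityMeasure_map
    (S.measurable_subMax (S.nonempty_of_card (by simp))).aemeasurable

theorem map_prodMk (S : IsMaxSample μ X r) {k : ℕ} {B : Finset ℕ} (hk : k ∉ B)
    (hB : B.card = r) :
    μ.map (fun ω => (X k ω, subMax X B ω)) = (μ.map (X 0)).prod (restLaw μ X r) :=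
  map_prodMk_subMax S.measurable S.indep S.ident S.one_le hk hB

theorem memLp_prod (S : IsMaxSample μ X r) :
    MemLp (fun p : ℝ × ℝ => max p.1 p.2) 2 ((μ.map (X 0)).prod (restLaw μ X r)) := by
  have hr : (Finset.range r).card = r := Finset.card_range r
  rw [← S.map_prodMk (Finset.notMem_range_self) hr,
    memLp_map_measure_iff (by fun_prop) (S.measurable_prodMk hr r).aemeasurable]
  refine S.memLp.congr_norm ?_ (ae_of_all _ fun ω => ?_)
  · exact ((measurable_fst.max measurable_snd).comp
      (S.measurable_prodMk hr r)).aestronglyMeasurable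
  · rw [Finset.range_add_one, subMax_insert (S.nonempty_of_card hr.ge)]
    rfl

theorem identDistrib_subMax (S : IsMaxSample μ X r) {A B : Finset ℕ} (hA : A.Nonempty)
    (hAB : A.card = B.card) : IdentDistrib (subMax X A) (subMax X B) μ μ where
  aemeasurable_fst := (S.measurable_subMax hA).aemeasurable
  aemeasurable_snd := (S.measurable_subMax
    (Finset.card_pos.1 (hAB ▸ Finset.card_pos.2 hA))).aemeasurable
  map_eq := map_subMax_eq S.measurable S.indep S.ident hA hAB

theorem memLp_subMax (S : IsMaxSample μ X r) {A : Finset ℕ} (hA : A.card = r + 1) :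
    MemLp (subMax X A) 2 μ :=
  (S.identDistrib_subMax (S.nonempty_of_card (by omega)) (by simpa using hA)).memLp_iff.2 S.memLp

theorem integral_subMax (S : IsMaxSample μ X r) {A : Finset ℕ} (hA : A.card = r + 1) :
    ∫ ω, subMax X A ω ∂μ = meanMax μ X r := by
  have := S.isProbabilityMeasure_law
  have := S.isProbabilityMeasure_restLaw
  have hr : (Finset.range r).card = r := Finset.card_range r
  rw [(S.identDistrib_subMax (S.nonempty_of_card (by omega)) (B := Finset.range (r + 1))
    (by simpa using hA)).integral_eq, meanMax, integral_maxMean S.memLp_prod,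
    ← S.map_prodMk (Finset.notMem_range_self) hr,
    integral_map (S.measurable_prodMk hr r).aemeasurable
      (measurable_fst.max measurable_snd).aestronglyMeasurable]
  refine integral_congr_ae (ae_of_all _ fun ω => ?_)
  simp only [Finset.range_add_one]
  rw [subMax_insert (S.nonempty_of_card hr.ge)]

theorem memLp_maxMean (S : IsMaxSample μ X r) (i : ℕ) :
    MemLp (fun ω => maxMean (restLaw μ X r) (X i ω)) 2 μ := by
  have := S.isProbabilityMeasure_law
  have := S.isProbabilityMeasure_restLaw
  have h := JEL.memLp_maxMean S.memLp_prod
  rw [← (S.ident i).map_eq] at h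
  exact h.comp_of_map (S.measurable i).aemeasurable

theorem memLp_proj (S : IsMaxSample μ X r) (i : ℕ) :
    MemLp (fun ω => proj μ X r (X i ω)) 2 μ :=
  (S.memLp_maxMean i).sub (memLp_const _)

theorem identDistrib_proj (S : IsMaxSample μ X r) (i : ℕ) :
    IdentDistrib (fun ω => proj μ X r (X i ω)) (fun ω => proj μ X r (X 0 ω)) μ μ :=
  (S.ident i).comp measurable_proj

theorem integral_proj (S : IsMaxSample μ X r) (i : ℕ) : ∫ ω, proj μ X r (X i ω) ∂μ = 0 := by
  have := S.isProbabilityMeasure_law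
  have := S.isProbabilityMeasure_restLaw
  rw [(S.identDistrib_proj i).integral_eq]
  have : ∫ x, proj μ X r x ∂(μ.map (X 0)) = 0 := by
    have hi := (JEL.memLp_maxMean S.memLp_prod).integrable one_le_two
    simp only [proj]
    rw [integral_sub hi (integrable_const _), integral_const]
    simp [meanMax]
  rwa [integral_map (S.measurable 0).aemeasurable measurable_proj.aestronglyMeasurable] at this

theorem integral_proj_sq (S : IsMaxSample μ X r) (i : ℕ) :
    ∫ ω, proj μ X r (X i ω) ^ 2 ∂μ = ∫ ω, proj μ X r (X 0 ω) ^ 2 ∂μ :=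
  ((S.identDistrib_proj i).comp (u := fun x => x ^ 2) (by fun_prop)).integral_eq

/-- The maximum of `r + 1` variables, centred at its conditional expectation given one of them, is
uncorrelated with the functions of the other variables. -/
theorem integral_subMax_insert_sub_mul (S : IsMaxSample μ X r) {k : ℕ} {B : Finset ℕ}
    (hB : B.card = r) {T : Set ℕ} (hT : Disjoint (B : Set ℕ) T) (hk : k ∈ T) {Z : Ω → ℝ}
    (hZ : Measurable Z) (hZT : Measurable[sigmaOf X T] Z) :
    ∫ ω, (subMax X (insert k B) ω - maxMean (restLaw μ X r) (X k ω)) * Z ω ∂μ = 0 := by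
  have := S.isProbabilityMeasure_law
  have := S.isProbabilityMeasure_restLaw
  have hBn := S.nonempty_of_card hB.ge
  simp_rw [subMax_insert hBn]
  refine integral_max_sub_maxMean_mul S.memLp_prod (S.measurable_subMax hBn) (S.measurable k) hZ
    (map_subMax_eq S.measurable S.indep S.ident hBn (by simpa using hB)) ?_
  refine indepFun_of_sigmaOf S.measurable S.indep hT
    (measurable_subMax_sigmaOf hBn fun i hi => hi) ?_
  exact Measurable.prodMk (measurable_sigmaOf hk) hZT

/-- Kernels at disjoint index sets are independent, so the case `j = 1` applies. -/
theorem exists_integral_sq_uStat_sub_le (S : IsMaxSample μ X r) :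
    ∃ C : ℝ, 0 ≤ C ∧ ∀ s : Finset ℕ, r + 1 ≤ s.card →
      ∫ ω, (uStat (r + 1) (fun A => subMax X A ω) s - meanMax μ X r) ^ 2 ∂μ ≤ C / s.card := by
  set D := ∫ ω, (subMax X (Finset.range (r + 1)) ω - meanMax μ X r) ^ 2 ∂μ with hD
  have hD0 : 0 ≤ D := integral_nonneg fun ω => sq_nonneg _
  refine ⟨D * ((r : ℝ) + 1) ^ 2, by positivity, fun s hs => ?_⟩
  have hmem : ∀ A ∈ s.powersetCard (r + 1), MemLp (fun ω => subMax X A ω - meanMax μ X r) 2 μ :=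
    fun A hA => (S.memLp_subMax (Finset.mem_powersetCard.1 hA).2).sub (memLp_const _)
  have h := integral_uStat_sq_le (μ := μ) (m := r + 1) (j := 1) (by omega) hs
    (Y := fun A ω => subMax X A ω - meanMax μ X r) hD0 hmem ?_ ?_
  · simp_rw [uStat_sub, uStat_const hs] at h
    refine h.trans_eq ?_
    simp only [Nat.choose_one_right]
    push_cast
    ring
  · intro A hA
    obtain ⟨-, hA⟩ := Finset.mem_powersetCard.1 hA
    exact ((S.identDistrib_subMax (S.nonempty_of_card (by omega)) (B := Finset.range (r + 1))
      (by simpa using hA)).comp (u := fun x => (x - meanMax μ X r) ^ 2)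
      (by fun_prop)).integral_eq.le
  · intro A hA B hB hAB
    have hA' := (Finset.mem_powersetCard.1 hA).2
    have hB' := (Finset.mem_powersetCard.1 hB).2
    have hdisj : Disjoint (A : Set ℕ) B := by
      rw [Finset.disjoint_coe, Finset.disjoint_iff_inter_eq_empty]
      exact Finset.card_eq_zero.1 (by omega)
    have hAn := S.nonempty_of_card (show r ≤ A.card by omega)
    have hBn := S.nonempty_of_card (show r ≤ B.card by omega)
    have hind : IndepFun (fun ω => subMax X A ω - meanMax μ X r)
        (fun ω => subMax X B ω - meanMax μ X r) μ :=
      (indepFun_of_sigmaOf S.measurable S.indep hdisj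
        (measurable_subMax_sigmaOf hAn fun i hi => hi)
        (measurable_subMax_sigmaOf hBn fun i hi => hi)).comp
        (φ := fun x => x - meanMax μ X r) (ψ := fun x => x - meanMax μ X r)
        (by fun_prop) (by fun_prop)
    rw [hind.integral_fun_mul_eq_mul_integral (hmem A hA).aestronglyMeasurable
      (hmem B hB).aestronglyMeasurable, integral_sub ((S.memLp_subMax hA').integrable one_le_two)
      (integrable_const _), S.integral_subMax hA']
    simp

/-- Given `X k`, this is a U-statistic in the other variables centred at its conditional mean;
disjoint index sets are uncorrelated and `j = 1` applies again. -/
theorem exists_integral_sq_uStat_insert_sub_le (S : IsMaxSample μ X r) :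
    ∃ C : ℝ, 0 ≤ C ∧ ∀ (k : ℕ) (s : Finset ℕ), k ∉ s → r ≤ s.card →
      ∫ ω, (uStat r (fun B => subMax X (insert k B) ω) s
        - maxMean (restLaw μ X r) (X k ω)) ^ 2 ∂μ ≤ C / s.card := by
  have hmM := measurable_maxMean (ν := restLaw μ X r)
  set D := ∫ p : ℝ × ℝ, (max p.1 p.2 - maxMean (restLaw μ X r) p.1) ^ 2
    ∂((μ.map (X 0)).prod (restLaw μ X r)) with hD
  have hD0 : 0 ≤ D := integral_nonneg fun ω => sq_nonneg _
  refine ⟨D * (r : ℝ) ^ 2, by positivity, fun k s hk hs => ?_⟩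
  have hcard : ∀ B ∈ s.powersetCard r, k ∉ B ∧ B.card = r := fun B hB =>
    ⟨fun h => hk ((Finset.mem_powersetCard.1 hB).1 h), (Finset.mem_powersetCard.1 hB).2⟩
  have hmem : ∀ B ∈ s.powersetCard r,
      MemLp (fun ω => subMax X (insert k B) ω - maxMean (restLaw μ X r) (X k ω)) 2 μ := by
    intro B hB
    obtain ⟨hkB, hBc⟩ := hcard B hB
    exact (S.memLp_subMax (by rw [Finset.card_insert_of_notMem hkB, hBc])).sub (S.memLp_maxMean k)
  have h := integral_uStat_sq_le (μ := μ) (m := r) (j := 1) S.one_le hs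
    (Y := fun B ω => subMax X (insert k B) ω - maxMean (restLaw μ X r) (X k ω)) hD0 hmem ?_ ?_
  · simp_rw [uStat_sub, uStat_const hs] at h
    refine h.trans_eq ?_
    simp only [Nat.choose_one_right]
    ring
  · intro B hB
    obtain ⟨hkB, hBc⟩ := hcard B hB
    rw [hD, ← S.map_prodMk hkB hBc, integral_map (S.measurable_prodMk hBc k).aemeasurable
      (by fun_prop)]
    simp_rw [subMax_insert (S.nonempty_of_card hBc.ge)]
    rfl
  · intro A hA B hB hAB
    obtain ⟨hkA, hAc⟩ := hcard A hA
    obtain ⟨hkB, hBc⟩ := hcard B hB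
    -- The second factor depends on `X k` as well, so `k` is put into `T`; only the variables
    -- indexed by `A` must stay outside.
    refine S.integral_subMax_insert_sub_mul hAc (T := (insert k B : Finset ℕ)) ?_ (by simp)
      ?_ ?_
    · rw [Finset.disjoint_coe, Finset.disjoint_insert_right, Finset.disjoint_iff_inter_eq_empty]
      exact ⟨hkA, Finset.card_eq_zero.1 (by omega)⟩
    · exact (S.measurable_subMax (Finset.insert_nonempty k B)).sub (hmM.comp (S.measurable k))
    · exact Measurable.sub (measurable_subMax_sigmaOf (Finset.insert_nonempty k B) fun i hi => hi)
        (hmM.comp (measurable_sigmaOf (by simp)))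

theorem memLp_subMax_sub_sum (S : IsMaxSample μ X r) {A : Finset ℕ} (hA : A.card = r + 1) :
    MemLp (fun ω => subMax X A ω - meanMax μ X r - ∑ i ∈ A, proj μ X r (X i ω)) 2 μ :=
  ((S.memLp_subMax hA).sub (memLp_const _)).sub (memLp_finsetSum _ fun i _ => S.memLp_proj i)

/-- The kernel of the second-order part of the U-statistic is degenerate: its values at index sets with
at most one common element are uncorrelated. -/
theorem integral_subMax_sub_sum_mul (S : IsMaxSample μ X r) {A B : Finset ℕ}
    (hA : A.card = r + 1) (hB : B.card = r + 1) (hAB : (A ∩ B).card < 2) :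
    ∫ ω, (subMax X A ω - meanMax μ X r - ∑ i ∈ A, proj μ X r (X i ω))
      * (subMax X B ω - meanMax μ X r - ∑ i ∈ B, proj μ X r (X i ω)) ∂μ = 0 := by
  have hBn := S.nonempty_of_card (show r ≤ B.card by omega)
  have hAn := S.nonempty_of_card (show r ≤ A.card by omega)
  -- `k` is the common index if there is one, and any index of `A` otherwise; the rest of `A` then
  -- avoids `B`.
  obtain ⟨k, hkA, hk⟩ : ∃ k ∈ A, Disjoint (A.erase k) B := by
    rcases (A ∩ B).eq_empty_or_nonempty with h | ⟨k, hk⟩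
    · obtain ⟨k, hk⟩ := hAn
      exact ⟨k, hk, (Finset.disjoint_iff_inter_eq_empty.2 h).mono_left (Finset.erase_subset k A)⟩
    · refine ⟨k, (Finset.mem_inter.1 hk).1, ?_⟩
      rw [Finset.disjoint_left]
      intro i hi hiB
      have := Finset.card_le_one.1 (show (A ∩ B).card ≤ 1 by omega) i
        (Finset.mem_inter.2 ⟨Finset.mem_of_mem_erase hi, hiB⟩) k hk
      exact Finset.ne_of_mem_erase hi this
  set Z : Ω → ℝ := fun ω => subMax X B ω - meanMax μ X r - ∑ i ∈ B, proj μ X r (X i ω) with hZ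
  have hZL : MemLp Z 2 μ := S.memLp_subMax_sub_sum hB
  have hpm : Measurable (proj μ X r) := measurable_proj
  have hZm : ∀ {m : MeasurableSpace Ω}, (∀ i ∈ B, Measurable[m] (X i)) → Measurable[m] Z :=
    fun h => measurable_subMax_sub_sum hBn h _ hpm
  have hZ0 : ∫ ω, Z ω ∂μ = 0 := by
    simp only [hZ]
    have h1 : Integrable (fun ω => subMax X B ω - meanMax μ X r) μ :=
      ((S.memLp_subMax hB).integrable one_le_two).sub (integrable_const _)
    rw [integral_sub h1 (integrable_finsetSum _ fun i _ => (S.memLp_proj i).integrable one_le_two),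
      integral_sub ((S.memLp_subMax hB).integrable one_le_two) (integrable_const _),
      integral_finsetSum _ fun i _ => (S.memLp_proj i).integrable one_le_two,
      S.integral_subMax hB]
    simp [S.integral_proj]
  have hAc : (A.erase k).card = r := by rw [Finset.card_erase_of_mem hkA, hA]; rfl
  have h1 : ∫ ω, (subMax X A ω - maxMean (restLaw μ X r) (X k ω)) * Z ω ∂μ = 0 := by
    have := S.integral_subMax_insert_sub_mul (k := k) hAc (T := (insert k B : Finset ℕ))
      (Z := Z) ?_ (by simp) (hZm fun i _ => S.measurable i)
      (hZm fun i hi => measurable_sigmaOf (by simp [hi]))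
    · rwa [Finset.insert_erase hkA] at this
    · rw [Finset.disjoint_coe, Finset.disjoint_insert_right]
      exact ⟨Finset.notMem_erase k A, hk⟩
  have h2 : ∀ i ∈ A.erase k, ∫ ω, proj μ X r (X i ω) * Z ω ∂μ = 0 := by
    intro i hi
    have hind : IndepFun (fun ω => proj μ X r (X i ω)) Z μ :=
      indepFun_of_sigmaOf S.measurable S.indep (S := {i}) (T := B)
        (by simpa using Finset.disjoint_left.1 hk hi)
        (measurable_proj.comp (measurable_sigmaOf rfl))
        (hZm fun i hi => measurable_sigmaOf hi)
    rw [hind.integral_fun_mul_eq_mul_integral (S.memLp_proj i).aestronglyMeasurable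
      hZL.aestronglyMeasurable, hZ0, mul_zero]
  -- The projection at `k` changes the centring of the maximum from its mean to its conditional mean
  -- given `X k`.
  have e : ∀ ω, (subMax X A ω - meanMax μ X r - ∑ i ∈ A, proj μ X r (X i ω)) * Z ω
      = (subMax X A ω - maxMean (restLaw μ X r) (X k ω)) * Z ω
        - ∑ i ∈ A.erase k, proj μ X r (X i ω) * Z ω := by
    intro ω
    rw [← Finset.add_sum_erase A _ hkA, ← Finset.sum_mul]
    simp only [proj]
    ring
  refine (integral_congr_ae (ae_of_all _ e)).trans ?_
  have hi1 : Integrable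
      (fun ω => (subMax X A ω - maxMean (restLaw μ X r) (X k ω)) * Z ω) μ :=
    ((S.memLp_subMax hA).sub (S.memLp_maxMean k)).integrable_mul hZL
  have hi2 : ∀ i ∈ A.erase k, Integrable (fun ω => proj μ X r (X i ω) * Z ω) μ :=
    fun i _ => (S.memLp_proj i).integrable_mul hZL
  rw [integral_sub hi1 (integrable_finsetSum _ hi2), h1, integral_finsetSum _ hi2,
    Finset.sum_eq_zero h2, sub_zero]

/-- Degeneracy allows `j = 2`. The resulting order `s.card ^ (-2)` beats the factor `n` from the
`√n` normalisation, so only the linear part matters in the limit. -/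
theorem exists_integral_sq_uStat_sub_sum_le (S : IsMaxSample μ X r) :
    ∃ C : ℝ, 0 ≤ C ∧ ∀ s : Finset ℕ, r + 1 ≤ s.card →
      ∫ ω, (uStat (r + 1) (fun A => subMax X A ω) s - meanMax μ X r
        - ((r : ℝ) + 1) / s.card * ∑ i ∈ s, proj μ X r (X i ω)) ^ 2 ∂μ
      ≤ C / s.card.choose 2 := by
  set D := ∫ ω, (subMax X (Finset.range (r + 1)) ω - meanMax μ X r) ^ 2 ∂μ with hD
  set σ2 := ∫ ω, proj μ X r (X 0 ω) ^ 2 ∂μ with hσ2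
  have hD0 : 0 ≤ D := integral_nonneg fun ω => sq_nonneg _
  have hσ0 : 0 ≤ σ2 := integral_nonneg fun ω => sq_nonneg _
  set C := 2 * D + 2 * ((r + 1 : ℕ) * ((r + 1 : ℕ) * σ2)) with hC
  refine ⟨C * ((r + 1).choose 2 : ℝ) ^ 2, by positivity, fun s hs => ?_⟩
  have h := integral_uStat_sq_le (μ := μ) (m := r + 1) (j := 2) (by have := S.one_le; omega) hs
    (Y := fun A ω => subMax X A ω - meanMax μ X r - ∑ i ∈ A, proj μ X r (X i ω))
    (C := C) (by positivity)
    (fun A hA => S.memLp_subMax_sub_sum (Finset.mem_powersetCard.1 hA).2) ?_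
    (fun A hA B hB hAB => S.integral_subMax_sub_sum_mul (Finset.mem_powersetCard.1 hA).2
      (Finset.mem_powersetCard.1 hB).2 hAB)
  · simp_rw [uStat_sub, uStat_const hs] at h
    simp_rw [uStat_sum _ (Nat.le_add_left 1 r) hs] at h
    push_cast at h
    refine h.trans_eq ?_
    ring
  · intro A hA
    obtain ⟨-, hA⟩ := Finset.mem_powersetCard.1 hA
    have hi1 : Integrable (fun ω => (subMax X A ω - meanMax μ X r) ^ 2) μ :=
      ((S.memLp_subMax hA).sub (memLp_const _)).integrable_sq
    have hi2 : Integrable (fun ω => ∑ i ∈ A, proj μ X r (X i ω) ^ 2) μ :=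
      integrable_finsetSum _ fun i _ => (S.memLp_proj i).integrable_sq
    calc ∫ ω, (subMax X A ω - meanMax μ X r - ∑ i ∈ A, proj μ X r (X i ω)) ^ 2 ∂μ
        ≤ ∫ ω, (2 * (subMax X A ω - meanMax μ X r) ^ 2
          + 2 * ((r + 1 : ℕ) * ∑ i ∈ A, proj μ X r (X i ω) ^ 2)) ∂μ := by
          refine integral_mono (S.memLp_subMax_sub_sum hA).integrable_sq
            ((hi1.const_mul _).add ((hi2.const_mul _).const_mul _)) fun ω => ?_
          have h1 := sq_sum_le_card_mul_sum_sq (s := A) (f := fun i => proj μ X r (X i ω))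
          rw [hA] at h1
          simp only
          nlinarith [sq_nonneg (subMax X A ω - meanMax μ X r + ∑ i ∈ A, proj μ X r (X i ω))]
      _ = C := by
          rw [integral_add (hi1.const_mul _) ((hi2.const_mul _).const_mul _),
            integral_const_mul, integral_const_mul, integral_const_mul,
            integral_finsetSum _ fun i _ => (S.memLp_proj i).integrable_sq,
            Finset.sum_congr rfl fun i _ => S.integral_proj_sq i, Finset.sum_const, hA,
            nsmul_eq_mul, hC, hD]
          congr 2
          exact ((S.identDistrib_subMax (S.nonempty_of_card (by omega))
            (B := Finset.range (r + 1)) (by simpa using hA)).comp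
            (u := fun x => (x - meanMax μ X r) ^ 2) (by fun_prop)).integral_eq

end IsMaxSample

end Moments

/-! ### The kernel mean as a weighted moment, and the conditional expectation. -/

section WeightedMoment

variable {Ω : Type*} [MeasurableSpace Ω] {μ : Measure Ω} [IsProbabilityMeasure μ]
  {X : ℕ → Ω → ℝ} {r : ℕ}

theorem measure_singleton_eq_zero_of_continuousAt_cdf {P : Measure ℝ} [IsProbabilityMeasure P]
    {x : ℝ} (h : ContinuousAt (cdf P) x) : P {x} = 0 := by
  rw [← measure_cdf P, StieltjesFunction.measure_singleton]
  have : Function.leftLim (cdf P) x = cdf P x :=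
    ((cdf P).mono.continuousAt_iff_leftLim_eq_rightLim.1 h).trans ((cdf P).rightLim_eq x)
  simp [this]

namespace IsMaxSample

/-- The law has no atom off `0`, so by Fubini the diagonal without the origin is null for the
product law. -/
theorem ae_eq_zero_of_tie (S : IsMaxSample μ X r)
    (hcont : ∀ x : ℝ, x ≠ 0 → ContinuousAt (cdf (μ.map (X 0))) x) :
    ∀ᵐ ω ∂μ, ∀ i j, i ≠ j → X i ω = X j ω → X i ω = 0 := by
  have := S.isProbabilityMeasure_law
  simp_rw [ae_all_iff]
  intro i j hij
  have hlaw : μ.map (fun ω => (X i ω, X j ω)) = (μ.map (X 0)).prod (μ.map (X 0)) := by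
    rw [(indepFun_iff_map_prod_eq_prod_map_map (S.measurable i).aemeasurable
      (S.measurable j).aemeasurable).1 (S.indep.indepFun hij), (S.ident i).map_eq,
      (S.ident j).map_eq]
  have hset : MeasurableSet {p : ℝ × ℝ | p.1 = p.2 ∧ p.1 ≠ 0} :=
    (measurableSet_eq_fun measurable_fst measurable_snd).inter
      (measurable_fst (measurableSet_singleton (0 : ℝ)).compl)
  have hnull : (μ.map (X 0)).prod (μ.map (X 0)) {p : ℝ × ℝ | p.1 = p.2 ∧ p.1 ≠ 0} = 0 := by
    rw [Measure.measure_prod_null hset]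
    refine ae_of_all _ fun x => ?_
    by_cases hx : x = 0
    · simp [hx]
    · refine measure_mono_null (t := {x}) ?_
        (measure_singleton_eq_zero_of_continuousAt_cdf (hcont x hx))
      rintro y ⟨hy, -⟩
      exact hy.symm
  rw [← hlaw, Measure.map_apply ((S.measurable i).prodMk (S.measurable j)) hset] at hnull
  filter_upwards [measure_eq_zero_iff_ae_notMem.1 hnull] with ω hω h
  by_contra h0
  exact hω ⟨h, h0⟩

theorem restLaw_Iic (S : IsMaxSample μ X r) (x : ℝ) :
    (restLaw μ X r).real (Set.Iic x) = cdf (μ.map (X 0)) x ^ r := by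
  have := S.isProbabilityMeasure_law
  rw [cdf_eq_real, Measure.real, Measure.real, map_subMax_Iic S.measurable S.indep S.ident
    (S.nonempty_of_card (by simp)), ENNReal.toReal_pow, Finset.card_range]

/-- Given `X j = x`, the other `r` variables are all at most `x` with probability `F(x) ^ r`. On
that event `X j` is the maximum, whence integrability. -/
theorem integral_indicator_eq_pwm (S : IsMaxSample μ X r) {A : Finset ℕ} (hA : A.card = r + 1)
    {j : ℕ} (hj : j ∈ A) :
    Integrable (fun ω => if subMax X (A.erase j) ω ≤ X j ω then X j ω else 0) μ ∧
    ∫ ω, (if subMax X (A.erase j) ω ≤ X j ω then X j ω else 0) ∂μ = pwm r (μ.map (X 0)) := by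
  have := S.isProbabilityMeasure_law
  have := S.isProbabilityMeasure_restLaw
  have hAc : (A.erase j).card = r := by rw [Finset.card_erase_of_mem hj, hA]; rfl
  set f : ℝ × ℝ → ℝ := fun p => if p.2 ≤ p.1 then p.1 else 0 with hf
  have hfm : Measurable f :=
    Measurable.ite (measurableSet_le measurable_snd measurable_fst) measurable_fst measurable_const
  have hfi : Integrable f ((μ.map (X 0)).prod (restLaw μ X r)) := by
    refine (S.memLp_prod.integrable one_le_two).norm.mono' hfm.aestronglyMeasurable
      (ae_of_all _ fun p => ?_)
    simp only [hf]
    split_ifs with h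
    · rw [max_eq_left h]
    · simp
  have hlaw := S.map_prodMk (Finset.notMem_erase j A) hAc
  have hm := (S.measurable_prodMk hAc j).aemeasurable (μ := μ)
  have hcomp : Integrable (f ∘ fun ω => (X j ω, subMax X (A.erase j) ω)) μ := by
    rw [← integrable_map_measure hfm.aestronglyMeasurable hm, hlaw]
    exact hfi
  refine ⟨hcomp, ?_⟩
  have h1 : ∫ ω, f (X j ω, subMax X (A.erase j) ω) ∂μ
      = ∫ p, f p ∂((μ.map (X 0)).prod (restLaw μ X r)) := by
    rw [← hlaw, integral_map hm hfm.aestronglyMeasurable]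
  refine h1.trans ?_
  rw [integral_prod _ hfi, pwm]
  refine integral_congr_ae (ae_of_all _ fun x => ?_)
  have h2 : ∀ y, f (x, y) = (Set.Iic x).indicator (fun _ => x) y := fun y => by
    simp [hf, Set.indicator_apply]
  simp only [h2]
  rw [integral_indicator_const _ measurableSet_Iic, S.restLaw_Iic, smul_eq_mul, mul_comm]

/-- The expected maximum of `r + 1` variables is `(r + 1) β_r`. -/
theorem meanMax_eq (S : IsMaxSample μ X r)
    (hcont : ∀ x : ℝ, x ≠ 0 → ContinuousAt (cdf (μ.map (X 0))) x) :
    meanMax μ X r = ((r : ℝ) + 1) * pwm r (μ.map (X 0)) := by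
  set A := Finset.range (r + 1) with hA
  have hAc : A.card = r + 1 := Finset.card_range _
  have hAn : A.Nonempty := S.nonempty_of_card (by omega)
  -- The sum runs over the indices attaining the maximum. If there are several, the common value is
  -- almost surely `0`, so counting it repeatedly is harmless.
  have key : ∀ᵐ ω ∂μ, subMax X A ω
      = ∑ j ∈ A, if subMax X (A.erase j) ω ≤ X j ω then X j ω else 0 := by
    filter_upwards [S.ae_eq_zero_of_tie hcont] with ω hω
    obtain ⟨j, hj, hmax⟩ := A.exists_max_image (fun i => X i ω) hAn
    have hne : ∀ i ∈ A, (A.erase i).Nonempty := fun i hi =>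
      S.nonempty_of_card (by rw [Finset.card_erase_of_mem hi, hAc]; rfl)
    have hMj : subMax X A ω = X j ω :=
      le_antisymm ((subMax_le_iff hAn).2 hmax) ((subMax_le_iff hAn).1 le_rfl j hj)
    rw [Finset.sum_eq_single_of_mem j hj, if_pos, hMj]
    · exact (subMax_le_iff (hne j hj)).2 fun i hi => hmax i (Finset.mem_of_mem_erase hi)
    · intro i hi hij
      split_ifs with h
      · exact hω i j hij (le_antisymm (hmax i hi)
          ((subMax_le_iff (hne i hi)).1 h j (Finset.mem_erase.2 ⟨hij.symm, hj⟩)))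
      · rfl
  rw [← S.integral_subMax hAc, integral_congr_ae key,
    integral_finsetSum _ fun j hj => (S.integral_indicator_eq_pwm hAc hj).1,
    Finset.sum_congr rfl fun j hj => (S.integral_indicator_eq_pwm hAc hj).2, Finset.sum_const, hAc,
    nsmul_eq_mul]
  push_cast
  rfl

/-- Tested on the events `X k ∈ t`: their indicators are functions of `X k`, with which the centred
maximum is uncorrelated. This links the explicit `maxMean` to the `condDistrib` in `projection`. -/
theorem condExp_subMax (S : IsMaxSample μ X r) {k : ℕ} {A : Finset ℕ} (hA : A.card = r + 1)
    (hk : k ∈ A) :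
    (fun ω => maxMean (restLaw μ X r) (X k ω))
      =ᵐ[μ] μ[subMax X A | MeasurableSpace.comap (X k) inferInstance] := by
  have := S.isProbabilityMeasure_restLaw
  have hmM : Measurable (maxMean (restLaw μ X r)) := measurable_maxMean
  have hAc : (A.erase k).card = r := by rw [Finset.card_erase_of_mem hk, hA]; rfl
  have hi1 := (S.memLp_subMax hA).integrable one_le_two
  have hi2 := (S.memLp_maxMean k).integrable one_le_two
  refine ae_eq_condExp_of_forall_setIntegral_eq (S.measurable k).comap_le hi1
    (fun s _ _ => hi2.integrableOn) ?_
    (hmM.comp (comap_measurable (X k))).stronglyMeasurable.aestronglyMeasurable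
  rintro _ ⟨t, ht, rfl⟩ -
  have hZ : Measurable (t.indicator fun _ => (1 : ℝ)) := measurable_const.indicator ht
  have h := S.integral_subMax_insert_sub_mul hAc (k := k) (T := {k}) (by simp) rfl
    (Z := fun ω => t.indicator (fun _ => (1 : ℝ)) (X k ω)) (hZ.comp (S.measurable k))
    (hZ.comp (measurable_sigmaOf rfl))
  rw [Finset.insert_erase hk] at h
  have e : ∀ ω, (subMax X A ω - maxMean (restLaw μ X r) (X k ω))
      * t.indicator (fun _ => (1 : ℝ)) (X k ω)
      = (X k ⁻¹' t).indicator (fun ω => subMax X A ω - maxMean (restLaw μ X r) (X k ω)) ω := by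
    intro ω
    by_cases hω : X k ω ∈ t <;> simp [hω]
  simp_rw [e] at h
  rw [integral_indicator (S.measurable k ht), integral_sub hi1.integrableOn hi2.integrableOn] at h
  linarith

/-- `projection` is centred at `β_r` and `proj` at the mean of the kernel; along `X 0` they differ
almost surely by a constant. -/
theorem variance_projection (S : IsMaxSample μ X r) :
    Var[fun ω => projection μ r X (X 0 ω); μ] = ∫ ω, proj μ X r (X 0 ω) ^ 2 ∂μ := by
  have hA : (Finset.range (r + 1)).card = r + 1 := Finset.card_range _
  have hAn := S.nonempty_of_card (show r ≤ (Finset.range (r + 1)).card by omega)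
  have h1 : (fun ω => projection μ r X (X 0 ω))
      =ᵐ[μ] fun ω => maxMean (restLaw μ X r) (X 0 ω) - pwm r (μ.map (X 0)) := by
    have h2 := condExp_ae_eq_integral_condDistrib' (μ := μ) (S.measurable 0)
      ((S.memLp_subMax hA).integrable one_le_two)
    filter_upwards [h2, S.condExp_subMax hA (k := 0) (by simp)] with ω hω hω'
    simp only [projection, maxKernel_fin_eq]
    change ∫ y, y ∂(condDistrib (subMax X (Finset.range (r + 1))) (X 0) μ (X 0 ω)) - _ = _
    rw [← hω, hω']
  rw [variance_congr h1, variance_sub_const (S.memLp_maxMean 0).aestronglyMeasurable,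
    ← variance_sub_const (S.memLp_maxMean 0).aestronglyMeasurable (meanMax μ X r)]
  exact variance_of_integral_eq_zero (S.memLp_proj 0).aestronglyMeasurable.aemeasurable
    (S.integral_proj 0)

end IsMaxSample

end WeightedMoment

/-- Differencing the averages gives `y n / n → 0`. Terms before some index are bounded by a fixed
`K`, later ones by `ε / 2 * k ≤ ε / 2 * n`. For squared projections this makes the maximum `o(n)`
with second moments only. -/
theorem tendsto_maxKernel_div {y : ℕ → ℝ} (hy : ∀ i, 0 ≤ y i) {c : ℝ}
    (h : Tendsto (fun n : ℕ => (∑ i ∈ Finset.range n, y i) / n) atTop (𝓝 c)) :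
    Tendsto (fun n : ℕ => maxKernel (fun k : Fin n => y k) / n) atTop (𝓝 0) := by
  have hyn : Tendsto (fun n : ℕ => y n / n) atTop (𝓝 0) := by
    have h1 := (tendsto_add_atTop_iff_nat 1).2 h
    have h2 : Tendsto (fun n : ℕ => ((n : ℝ) + 1) / n) atTop (𝓝 1) := by
      have := (tendsto_const_nhds (x := (1 : ℝ))).add tendsto_one_div_atTop_nhds_zero_nat
      rw [add_zero] at this
      refine this.congr' ?_
      filter_upwards [eventually_ge_atTop 1] with n hn
      have : (n : ℝ) ≠ 0 := by positivity
      field_simp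
    have h3 := (h1.mul h2).sub h
    rw [mul_one, sub_self] at h3
    refine h3.congr' ?_
    filter_upwards [eventually_ge_atTop 1] with n hn
    have : (n : ℝ) ≠ 0 := by positivity
    rw [Finset.sum_range_succ]
    push_cast
    field_simp
    ring
  rw [Metric.tendsto_atTop]
  intro ε hε
  obtain ⟨N, hN⟩ := eventually_atTop.1 (hyn.eventually (gt_mem_nhds (half_pos hε)))
  set K := ∑ i ∈ Finset.range (N + 1), y i with hK
  have hK0 : 0 ≤ K := Finset.sum_nonneg fun i _ => hy i
  have hKn : Tendsto (fun n : ℕ => K / n) atTop (𝓝 0) := tendsto_const_div_atTop_nhds_zero_nat K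
  obtain ⟨N', hN'⟩ := eventually_atTop.1 (hKn.eventually (gt_mem_nhds (half_pos hε)))
  refine ⟨max N' 1, fun n hn => ?_⟩
  have hn1 : 1 ≤ n := (le_max_right _ _).trans hn
  have hn0 : (0 : ℝ) < n := by positivity
  have : Nonempty (Fin n) := ⟨⟨0, hn1⟩⟩
  have hle : maxKernel (fun k : Fin n => y k) ≤ K + ε / 2 * n := by
    refine maxKernel_le_iff.2 fun k => ?_
    rcases lt_or_ge (k : ℕ) (N + 1) with hk | hk
    · have h1 := Finset.single_le_sum (f := y) (fun i _ => hy i) (Finset.mem_range.2 hk)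
      have : 0 ≤ ε / 2 * n := by positivity
      linarith
    · have h1 := hN k (by omega)
      have hk0 : (k : ℝ) ≤ n := by exact_mod_cast k.2.le
      rw [div_lt_iff₀ (by exact_mod_cast (Nat.succ_pos N).trans_le hk)] at h1
      have : ε / 2 * (k : ℕ) ≤ ε / 2 * n := by gcongr
      linarith
  have h0 : 0 ≤ maxKernel (fun k : Fin n => y k) :=
    (hy 0).trans (le_maxKernel (fun k : Fin n => y k) ⟨0, hn1⟩)
  rw [Real.dist_eq, sub_zero, abs_of_nonneg (by positivity), div_lt_iff₀ hn0]
  have h2 := hN' n ((le_max_left _ _).trans hn)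
  rw [div_lt_iff₀ hn0] at h2
  linarith

/-! ### Tools for convergence in probability. -/

section Convergence

variable {Ω : Type*} [MeasurableSpace Ω] {μ : Measure Ω}

theorem tendsto_measure_exists_le_abs_sub {κ : Type*} [Fintype κ] {Y : κ → ℕ → Ω → ℝ} {c : κ → ℝ}
    (hY : ∀ i, TendstoInMeasure μ (Y i) atTop fun _ => c i) {δ : ℝ} (hδ : 0 < δ) :
    Tendsto (fun n => μ {ω | ∃ i, δ ≤ |Y i n ω - c i|}) atTop (𝓝 0) := by
  have h : Tendsto (fun n => ∑ i, μ {ω | δ ≤ |Y i n ω - c i|}) atTop (𝓝 0) := by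
    have := tendsto_finsetSum Finset.univ fun i _ => tendstoInMeasure_iff_norm.1 (hY i) δ hδ
    simpa using this
  refine tendsto_of_tendsto_of_tendsto_of_le_of_le tendsto_const_nhds h (fun _ => zero_le)
    fun n => ?_
  refine le_trans (measure_mono ?_) (measure_iUnion_fintype_le μ _)
  rintro ω ⟨i, hi⟩
  exact Set.mem_iUnion.2 ⟨i, hi⟩

/-- An event which holds when finitely many variables are close to their limits in probability
has a probability tending to one. -/
theorem tendsto_measure_one_of_forall [IsProbabilityMeasure μ] {κ : Type*} [Fintype κ]
    {Y : κ → ℕ → Ω → ℝ} {c : κ → ℝ} (hY : ∀ i, TendstoInMeasure μ (Y i) atTop fun _ => c i)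
    {p : ℕ → Ω → Prop} {δ : ℝ} (hδ : 0 < δ)
    (h : ∀ᶠ n in atTop, ∀ ω, (∀ i, |Y i n ω - c i| < δ) → p n ω) :
    Tendsto (fun n => μ {ω | p n ω}) atTop (𝓝 1) := by
  have h1 : Tendsto (fun n => 1 - μ {ω | ∃ i, δ ≤ |Y i n ω - c i|}) atTop (𝓝 1) := by
    have := ENNReal.Tendsto.sub tendsto_const_nhds (tendsto_measure_exists_le_abs_sub hY hδ)
      (Or.inl ENNReal.one_ne_top)
    simpa using this
  refine tendsto_of_tendsto_of_tendsto_of_le_of_le' h1 tendsto_const_nhds ?_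
    (Eventually.of_forall fun n => prob_le_one)
  filter_upwards [h] with n hn
  rw [tsub_le_iff_right, ← measure_univ (μ := μ)]
  refine le_trans (measure_mono ?_) (measure_union_le _ _)
  intro ω _
  by_cases hω : ∃ i, δ ≤ |Y i n ω - c i|
  · exact Or.inr hω
  · push Not at hω
    exact Or.inl (hn ω hω)

/-- Continuous mapping for convergence in probability to constants: a sequence converges in
probability if its error is dominated by a continuous function of convergent sequences, as soon as
the latter are close to their limits. -/
theorem tendstoInMeasure_of_abs_sub_le {κ : Type*} [Fintype κ] {Y : κ → ℕ → Ω → ℝ} {c : κ → ℝ}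
    (hY : ∀ i, TendstoInMeasure μ (Y i) atTop fun _ => c i) {F : ℕ → Ω → ℝ} {d : ℝ}
    {Φ : (κ → ℝ) → ℝ} (hΦ : ContinuousAt Φ c) (hΦc : Φ c = 0) {δ : ℝ} (hδ : 0 < δ)
    (h : ∀ᶠ n in atTop, ∀ ω, (∀ i, |Y i n ω - c i| < δ) →
      |F n ω - d| ≤ Φ fun i => Y i n ω) :
    TendstoInMeasure μ F atTop fun _ => d := by
  rw [tendstoInMeasure_iff_norm]
  intro ε hε
  obtain ⟨η, hη, hΦη⟩ := Metric.continuousAt_iff.1 hΦ ε hε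
  refine tendsto_of_tendsto_of_tendsto_of_le_of_le' tendsto_const_nhds
    (tendsto_measure_exists_le_abs_sub hY (lt_min hδ hη)) (Eventually.of_forall fun _ => zero_le) ?_
  filter_upwards [h] with n hn
  refine measure_mono fun ω hω => ?_
  by_contra hcon
  simp only [Set.mem_ofPred_eq, not_exists, not_le] at hcon
  have h1 := hn ω fun i => (hcon i).trans_le (min_le_left _ _)
  have h2 := hΦη (x := fun i => Y i n ω)
    ((dist_pi_lt_iff hη).2 fun i => (hcon i).trans_le (min_le_right _ _))
  rw [hΦc, Real.dist_eq, sub_zero] at h2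
  exact absurd ((h1.trans (le_abs_self _)).trans_lt h2) (not_lt.2 hω)

variable [IsProbabilityMeasure μ]

theorem tendstoInMeasure_zero_of_integral_le {f : ℕ → Ω → ℝ} {c : ℕ → ℝ}
    (hf : ∀ n ω, 0 ≤ f n ω) (hint : ∀ᶠ n in atTop, Integrable (f n) μ)
    (hc : ∀ᶠ n in atTop, ∫ ω, f n ω ∂μ ≤ c n) (hc0 : Tendsto c atTop (𝓝 0)) :
    TendstoInMeasure μ f atTop fun _ => 0 := by
  rw [tendstoInMeasure_iff_measureReal_norm]
  intro ε hε
  have h0 : Tendsto (fun n => c n / ε) atTop (𝓝 0) := by simpa using hc0.div_const ε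
  refine tendsto_of_tendsto_of_tendsto_of_le_of_le' tendsto_const_nhds h0
    (Eventually.of_forall fun _ => measureReal_nonneg) ?_
  filter_upwards [hint, hc] with n h1 h2
  have h3 := mul_meas_ge_le_integral_of_nonneg (ae_of_all μ (hf n)) h1 ε
  simp only [sub_zero, Real.norm_eq_abs, abs_of_nonneg (hf n _)]
  rw [le_div_iff₀ hε]
  linarith

theorem tendstoInMeasure_zero_of_integral_sq_le {f : ℕ → Ω → ℝ} {c : ℕ → ℝ}
    (hint : ∀ᶠ n in atTop, MemLp (f n) 2 μ)
    (hc : ∀ᶠ n in atTop, ∫ ω, f n ω ^ 2 ∂μ ≤ c n) (hc0 : Tendsto c atTop (𝓝 0)) :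
    TendstoInMeasure μ f atTop fun _ => 0 := by
  have h := tendstoInMeasure_zero_of_integral_le (μ := μ) (f := fun n ω => f n ω ^ 2)
    (fun n ω => sq_nonneg _) (hint.mono fun n hn => hn.integrable_sq) hc hc0
  refine tendstoInMeasure_of_abs_sub_le (Y := fun _ : Unit => fun n ω => f n ω ^ 2)
    (c := fun _ => 0) (fun _ => h) (Φ := fun x => Real.sqrt (x ()))
    (Real.continuous_sqrt.comp (continuous_apply ())).continuousAt (by simp)
    one_pos (Eventually.of_forall fun n ω _ => ?_)
  simp [Real.sqrt_sq_eq_abs]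

/-- The product of a sequence bounded in mean square and of a sequence tending to zero in
probability tends to zero in probability. -/
theorem tendstoInMeasure_mul_of_integral_sq_le {A Y : ℕ → Ω → ℝ} {C : ℝ}
    (hint : ∀ᶠ n in atTop, MemLp (A n) 2 μ) (hC : ∀ᶠ n in atTop, ∫ ω, A n ω ^ 2 ∂μ ≤ C)
    (hY : TendstoInMeasure μ Y atTop fun _ => 0) :
    TendstoInMeasure μ (fun n ω => A n ω * Y n ω) atTop fun _ => 0 := by
  rw [tendstoInMeasure_iff_measureReal_norm] at hY ⊢
  simp only [sub_zero, Real.norm_eq_abs] at hY ⊢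
  intro ε hε
  rw [Metric.tendsto_atTop']
  intro η hη
  have hC0 : 0 ≤ max C 0 := le_max_right _ _
  -- The level at which Chebyshev's inequality gives `|A n| ≥ K` probability below `η / 2`; the `+
  -- 1` makes the inequality strict.
  set K := Real.sqrt (2 * (max C 0 + 1) / η) with hK
  have hK0 : 0 < K := Real.sqrt_pos.2 (by positivity)
  have hKsq : K ^ 2 = 2 * (max C 0 + 1) / η := Real.sq_sqrt (by positivity)
  obtain ⟨N, hN⟩ := eventually_atTop.1 (hint.and (hC.and
    ((hY (ε / K) (by positivity)).eventually (gt_mem_nhds (half_pos hη)))))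
  refine ⟨N, fun n hn => ?_⟩
  obtain ⟨h1, h2, h3⟩ := hN n hn.le
  have h4 := mul_meas_ge_le_integral_of_nonneg (ae_of_all μ fun ω => sq_nonneg (A n ω))
    h1.integrable_sq (K ^ 2)
  have h5 : μ.real {ω | K ^ 2 ≤ A n ω ^ 2} < η / 2 := by
    have h6 : K ^ 2 * μ.real {ω | K ^ 2 ≤ A n ω ^ 2} < K ^ 2 * (η / 2) := by
      refine (h4.trans h2).trans_lt ?_
      rw [hKsq]
      field_simp
      linarith [le_max_left C 0]
    exact lt_of_mul_lt_mul_left h6 (by positivity)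
  rw [Real.dist_eq, sub_zero, abs_of_nonneg measureReal_nonneg]
  refine lt_of_le_of_lt ((measureReal_mono ?_).trans (measureReal_union_le
    {ω | K ^ 2 ≤ A n ω ^ 2} {ω | ε / K ≤ |Y n ω|})) (by linarith)
  intro ω hω
  by_contra hcon
  simp only [Set.mem_union, Set.mem_ofPred_eq, not_or, not_le] at hcon
  have h7 : |A n ω| < K := abs_lt_of_sq_lt_sq hcon.1 hK0.le
  have h8 : |A n ω * Y n ω| < ε := by
    rw [abs_mul]
    calc |A n ω| * |Y n ω| ≤ |A n ω| * (ε / K) := by gcongr; exact hcon.2.le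
      _ < K * (ε / K) := by gcongr
      _ = ε := by field_simp
  exact absurd h8 (not_lt.2 hω)

end Convergence

/-! ### Linearisation of the pseudo-values. -/

section PseudoValues

variable {Ω : Type*} [MeasurableSpace Ω] {μ : Measure Ω} {X : ℕ → Ω → ℝ} {r : ℕ}

theorem measurable_uStat {m : ℕ} {s : Finset ℕ} {Y : Finset ℕ → Ω → ℝ}
    (hY : ∀ A ∈ s.powersetCard m, Measurable (Y A)) :
    Measurable fun ω => uStat m (fun A => Y A ω) s :=
  (Finset.measurable_sum _ hY).const_mul _

theorem memLp_uStat {m : ℕ} {s : Finset ℕ} {Y : Finset ℕ → Ω → ℝ}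
    (hY : ∀ A ∈ s.powersetCard m, MemLp (Y A) 2 μ) :
    MemLp (fun ω => uStat m (fun A => Y A ω) s) 2 μ :=
  (memLp_finsetSum _ hY).const_mul _

theorem sum_pseudoValue (x : ℕ → ℝ) {n : ℕ} (hn : r + 2 ≤ n) :
    ∑ k ∈ Finset.range n, pseudoValue r x n k = n * betaHat r x (Finset.range n) := by
  have hc : r + 1 < (Finset.range n).card := by
    rw [Finset.card_range]
    omega
  simp only [pseudoValue, Finset.sum_sub_distrib, ← Finset.mul_sum, betaHat_eq_uStat,
    sum_uStat_erase _ hc, Finset.sum_const, Finset.card_range, nsmul_eq_mul]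
  ring

theorem mean_pseudoValue_sub {β : ℝ}
    (hβ : meanMax μ X r = ((r : ℝ) + 1) * β) {n : ℕ} (hn : r + 2 ≤ n) (ω : Ω) :
    1 / (n : ℝ) * ∑ k : Fin n, (pseudoValue r (fun i => X i ω) n k - β)
      = 1 / ((r : ℝ) + 1) * (uStat (r + 1) (fun A => subMax X A ω) (Finset.range n)
        - meanMax μ X r) := by
  have hn0 : (n : ℝ) ≠ 0 := by
    have : 0 < n := by omega
    positivity
  rw [Fin.sum_univ_eq_sum_range (fun k => pseudoValue r (fun i => X i ω) n k - β) n,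
    Finset.sum_sub_distrib, sum_pseudoValue _ hn, betaHat_eq_uStat, hβ]
  simp only [Finset.sum_const, Finset.card_range, nsmul_eq_mul]
  change 1 / (n : ℝ) * (n * (1 / ((r : ℝ) + 1) * uStat (r + 1) (fun A => subMax X A ω)
    (Finset.range n)) - n * β) = _
  field_simp

namespace IsMaxSample

theorem measurable_betaHat (S : IsMaxSample μ X r) (s : Finset ℕ) :
    Measurable fun ω => betaHat r (fun i => X i ω) s := by
  simp_rw [betaHat_eq_uStat]
  exact (measurable_uStat (Y := fun A => subMax X A) fun A hA => S.measurable_subMax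
    (S.nonempty_of_card (by rw [(Finset.mem_powersetCard.1 hA).2]; omega))).const_mul _

theorem measurable_pseudoValue (S : IsMaxSample μ X r) (n k : ℕ) :
    Measurable fun ω => pseudoValue r (fun i => X i ω) n k :=
  ((S.measurable_betaHat _).const_mul _).sub ((S.measurable_betaHat _).const_mul _)

theorem measurable_jelLogRatio (S : IsMaxSample μ X r) (n : ℕ) (β : ℝ) :
    Measurable fun ω => jelLogRatio r (fun i => X i ω) n β :=
  (measurable_logRatio β).comp (measurable_pi_lambda _ fun k : Fin n => S.measurable_pseudoValue n k)

variable [IsProbabilityMeasure μ]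

theorem memLp_uStat_subMax (S : IsMaxSample μ X r) (s : Finset ℕ) :
    MemLp (fun ω => uStat (r + 1) (fun A => subMax X A ω) s) 2 μ :=
  memLp_uStat (Y := fun A => subMax X A) fun _ hA =>
    S.memLp_subMax (Finset.mem_powersetCard.1 hA).2

/-- The `k`-th pseudo-value is, up to a remainder tending to zero in mean square, a function of
the `k`-th observation. -/
theorem exists_integral_sq_pseudoValue_sub_le (S : IsMaxSample μ X r) {β : ℝ}
    (hβ : meanMax μ X r = ((r : ℝ) + 1) * β) :
    ∃ C : ℝ, ∀ n, r + 2 ≤ n → ∀ k < n,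
      MemLp (fun ω => pseudoValue r (fun i => X i ω) n k - β - proj μ X r (X k ω)) 2 μ ∧
      ∫ ω, (pseudoValue r (fun i => X i ω) n k - β - proj μ X r (X k ω)) ^ 2 ∂μ
        ≤ C / ((n : ℝ) - 1) := by
  obtain ⟨C1, hC1, h1⟩ := S.exists_integral_sq_uStat_insert_sub_le
  obtain ⟨C2, hC2, h2⟩ := S.exists_integral_sq_uStat_sub_le
  refine ⟨2 * C1 + 2 * C2, fun n hn k hk => ?_⟩
  set s := (Finset.range n).erase k with hs
  have hks : k ∉ s := Finset.notMem_erase k _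
  have hsc : s.card = n - 1 := by
    rw [hs, Finset.card_erase_of_mem (Finset.mem_range.2 hk), Finset.card_range]
  have hscR : (s.card : ℝ) = (n : ℝ) - 1 := by
    rw [hsc, Nat.cast_sub (by omega)]
    simp
  set W : Ω → ℝ := fun ω => uStat r (fun B => subMax X (insert k B) ω) s
    - maxMean (restLaw μ X r) (X k ω) with hW
  set U : Ω → ℝ := fun ω => uStat (r + 1) (fun A => subMax X A ω) s - meanMax μ X r with hU
  -- By `hβ`, `β + r / (r + 1) * meanMax = meanMax`, so the constants cancel exactly.
  have e : ∀ ω, pseudoValue r (fun i => X i ω) n k - β - proj μ X r (X k ω)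
      = W ω - (r : ℝ) / (r + 1) * U ω := by
    intro ω
    have h := pseudoValue_eq (fun A => subMax X A ω) (r := r) (s := Finset.range n)
      (by simpa using hn) (Finset.mem_range.2 hk)
    rw [Finset.card_range] at h
    rw [pseudoValue, betaHat_eq_uStat, betaHat_eq_uStat]
    refine (congrArg (fun x => x - β - proj μ X r (X k ω)) h).trans ?_
    simp only [hW, hU, proj, hβ]
    field_simp
    ring
  simp_rw [e]
  have hWL : MemLp W 2 μ := by
    refine (memLp_uStat (Y := fun B => subMax X (insert k B)) fun B hB => S.memLp_subMax ?_).sub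
      (S.memLp_maxMean k)
    obtain ⟨hBs, hBc⟩ := Finset.mem_powersetCard.1 hB
    rw [Finset.card_insert_of_notMem fun h => hks (hBs h), hBc]
  have hUL : MemLp U 2 μ := (S.memLp_uStat_subMax s).sub (memLp_const _)
  refine ⟨hWL.sub (hUL.const_mul _), ?_⟩
  have hr0 : (0 : ℝ) ≤ (r : ℝ) / (r + 1) := by positivity
  have hr1 : (r : ℝ) / (r + 1) ≤ 1 := by
    rw [div_le_one (by positivity)]
    linarith
  calc ∫ ω, (W ω - (r : ℝ) / (r + 1) * U ω) ^ 2 ∂μ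
      ≤ ∫ ω, (2 * W ω ^ 2 + 2 * U ω ^ 2) ∂μ := by
        refine integral_mono (hWL.sub (hUL.const_mul _)).integrable_sq
          ((hWL.integrable_sq.const_mul _).add (hUL.integrable_sq.const_mul _)) fun ω => ?_
        have h3 : ((r : ℝ) / (r + 1)) ^ 2 * U ω ^ 2 ≤ 1 * U ω ^ 2 :=
          mul_le_mul_of_nonneg_right (pow_le_one₀ hr0 hr1) (sq_nonneg _)
        simp only
        nlinarith [sq_nonneg (W ω + (r : ℝ) / (r + 1) * U ω)]
    _ = 2 * ∫ ω, W ω ^ 2 ∂μ + 2 * ∫ ω, U ω ^ 2 ∂μ := by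
        rw [integral_add (hWL.integrable_sq.const_mul _) (hUL.integrable_sq.const_mul _),
          integral_const_mul, integral_const_mul]
    _ ≤ 2 * (C1 / s.card) + 2 * (C2 / s.card) := by
        have h3 := h1 k s hks (by omega)
        have h4 := h2 s (by omega)
        exact add_le_add (mul_le_mul_of_nonneg_left h3 two_pos.le)
          (mul_le_mul_of_nonneg_left h4 two_pos.le)
    _ = _ := by
        rw [hscR]
        ring

end IsMaxSample

end PseudoValues

/-! ### Limits of the mean, mean square and maximum of the pseudo-values. -/

section Limits

variable {Ω : Type*} [MeasurableSpace Ω] {μ : Measure Ω} {X : ℕ → Ω → ℝ} {r : ℕ}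

/-- The normalized estimation error of the estimator of `β_r`, multiplied by `√n`. -/
noncomputable def normError (μ : Measure Ω) (X : ℕ → Ω → ℝ) (r n : ℕ) (ω : Ω) : ℝ :=
  √n * (1 / ((r : ℝ) + 1) * (uStat (r + 1) (fun A => subMax X A ω) (Finset.range n)
    - meanMax μ X r))

/-- The mean square of the centred pseudo-values. -/
noncomputable def meanSq (X : ℕ → Ω → ℝ) (r : ℕ) (β : ℝ) (n : ℕ) (ω : Ω) : ℝ :=
  1 / (n : ℝ) * ∑ k : Fin n, (pseudoValue r (fun i => X i ω) n k - β) ^ 2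

/-- The mean square of the projections of the observations. -/
noncomputable def meanSqProj (μ : Measure Ω) (X : ℕ → Ω → ℝ) (r n : ℕ) (ω : Ω) : ℝ :=
  (∑ k ∈ Finset.range n, proj μ X r (X k ω) ^ 2) / n

/-- The mean square of the differences between pseudo-values and projections. -/
noncomputable def meanSqRem (μ : Measure Ω) (X : ℕ → Ω → ℝ) (r : ℕ) (β : ℝ) (n : ℕ) (ω : Ω) : ℝ :=
  (∑ k ∈ Finset.range n,
    (pseudoValue r (fun i => X i ω) n k - β - proj μ X r (X k ω)) ^ 2) / n

/-- The largest squared projection, divided by the sample size. -/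
noncomputable def maxSqProj (μ : Measure Ω) (X : ℕ → Ω → ℝ) (r n : ℕ) (ω : Ω) : ℝ :=
  maxKernel (fun k : Fin n => proj μ X r (X k ω) ^ 2) / n

/-- Expand the square of projection plus remainder and apply Cauchy-Schwarz to the cross term. -/
theorem abs_meanSq_sub_meanSqProj_le (β : ℝ) (n : ℕ) (ω : Ω) :
    |meanSq X r β n ω - meanSqProj μ X r n ω|
      ≤ meanSqRem μ X r β n ω + 2 * √(meanSqProj μ X r n ω * meanSqRem μ X r β n ω) := by
  set a : ℕ → ℝ := fun k => proj μ X r (X k ω) with ha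
  set b : ℕ → ℝ := fun k => pseudoValue r (fun i => X i ω) n k - β - proj μ X r (X k ω) with hb
  have e1 : meanSq X r β n ω = (∑ k ∈ Finset.range n, (a k + b k) ^ 2) / n := by
    rw [meanSq, Fin.sum_univ_eq_sum_range
      (fun k => (pseudoValue r (fun i => X i ω) n k - β) ^ 2) n, one_div_mul_eq_div]
    simp only [ha, hb]
    congr 1
    exact Finset.sum_congr rfl fun k _ => by ring
  have e2 : meanSq X r β n ω - meanSqProj μ X r n ω
      = meanSqRem μ X r β n ω + 2 * ((∑ k ∈ Finset.range n, a k * b k) / n) := by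
    rw [e1, meanSqProj, meanSqRem]
    have : ∀ k, (a k + b k) ^ 2 = a k ^ 2 + b k ^ 2 + 2 * (a k * b k) := fun k => by ring
    simp_rw [this, Finset.sum_add_distrib, ← Finset.mul_sum]
    simp only [ha, hb]
    ring
  have hR0 : 0 ≤ meanSqRem μ X r β n ω :=
    div_nonneg (Finset.sum_nonneg fun _ _ => sq_nonneg _) (Nat.cast_nonneg n)
  have hcs : |(∑ k ∈ Finset.range n, a k * b k) / n|
      ≤ √(meanSqProj μ X r n ω * meanSqRem μ X r β n ω) := by
    refine Real.abs_le_sqrt ?_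
    rw [div_pow, meanSqProj, meanSqRem, div_mul_div_comm, ← sq (n : ℝ)]
    gcongr
    exact Finset.sum_mul_sq_le_sq_mul_sq _ _ _
  rw [e2]
  refine (abs_add_le _ _).trans ?_
  rw [abs_of_nonneg hR0, abs_mul, abs_two]
  gcongr

/-- One squared remainder is at most the sum of all, `n * meanSqRem`; control of the average
therefore suffices, and no uniform estimate of the remainders is needed. -/
theorem abs_pseudoValue_sub_le (β : ℝ) {n : ℕ} (k : Fin n) (ω : Ω) :
    |pseudoValue r (fun i => X i ω) n k - β|
      ≤ √n * √(2 * maxSqProj μ X r n ω + 2 * meanSqRem μ X r β n ω) := by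
  have hn : 0 < n := k.pos
  have hn' : (0 : ℝ) < n := by positivity
  rw [← Real.sqrt_mul hn'.le]
  refine Real.abs_le_sqrt ?_
  have h1 := le_maxKernel (fun k : Fin n => proj μ X r (X k ω) ^ 2) k
  have h2 := Finset.single_le_sum (f := fun k : ℕ =>
    (pseudoValue r (fun i => X i ω) n k - β - proj μ X r (X k ω)) ^ 2)
    (fun _ _ => sq_nonneg _) (Finset.mem_range.2 k.2)
  have e : (n : ℝ) * (2 * maxSqProj μ X r n ω + 2 * meanSqRem μ X r β n ω)
      = 2 * maxKernel (fun k : Fin n => proj μ X r (X k ω) ^ 2) + 2 * ∑ k ∈ Finset.range n,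
        (pseudoValue r (fun i => X i ω) n k - β - proj μ X r (X k ω)) ^ 2 := by
    rw [maxSqProj, meanSqRem]
    field_simp
  rw [e]
  nlinarith [sq_nonneg (pseudoValue r (fun i => X i ω) n k - β - 2 * proj μ X r (X k ω))]

namespace IsMaxSample

theorem measurable_normError (S : IsMaxSample μ X r) (n : ℕ) : Measurable (normError μ X r n) :=
  (((measurable_uStat (Y := fun A => subMax X A) fun A hA => S.measurable_subMax
    (S.nonempty_of_card (by rw [(Finset.mem_powersetCard.1 hA).2]; omega))).sub_const
    _).const_mul _).const_mul _

variable [IsProbabilityMeasure μ]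

theorem indep_proj (S : IsMaxSample μ X r) :
    iIndepFun (fun k ω => proj μ X r (X k ω)) μ :=
  S.indep.comp (fun _ => proj μ X r) fun _ => measurable_proj

theorem measurable_proj_comp (S : IsMaxSample μ X r) (k : ℕ) :
    Measurable fun ω => proj μ X r (X k ω) :=
  measurable_proj.comp (S.measurable k)

theorem ae_tendsto_meanSqProj (S : IsMaxSample μ X r) :
    ∀ᵐ ω ∂μ, Tendsto (fun n => meanSqProj μ X r n ω) atTop
      (𝓝 (∫ ω, proj μ X r (X 0 ω) ^ 2 ∂μ)) :=
  strong_law_ae_real (fun k ω => proj μ X r (X k ω) ^ 2) (S.memLp_proj 0).integrable_sq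
    (fun _ _ hij => (S.indep_proj.indepFun hij).comp (φ := fun x => x ^ 2) (ψ := fun x => x ^ 2)
      (by fun_prop) (by fun_prop))
    fun i => (S.identDistrib_proj i).comp (u := fun x => x ^ 2) (by fun_prop)

theorem tendstoInMeasure_meanSqProj (S : IsMaxSample μ X r) :
    TendstoInMeasure μ (meanSqProj μ X r) atTop fun _ => ∫ ω, proj μ X r (X 0 ω) ^ 2 ∂μ :=
  tendstoInMeasure_of_tendsto_ae (fun _ => ((Finset.measurable_sum _ fun k _ =>
    (S.measurable_proj_comp k).pow_const 2).div_const _).aestronglyMeasurable)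
    S.ae_tendsto_meanSqProj

theorem tendstoInMeasure_maxSqProj (S : IsMaxSample μ X r) :
    TendstoInMeasure μ (maxSqProj μ X r) atTop fun _ => 0 := by
  refine tendstoInMeasure_of_tendsto_ae (fun n => ?_) ?_
  · rcases Nat.eq_zero_or_pos n with rfl | hn
    · have : maxSqProj μ X r 0 = fun _ => 0 := by
        ext ω
        simp [maxSqProj]
      rw [this]
      exact aestronglyMeasurable_const
    · have : Nonempty (Fin n) := ⟨⟨0, hn⟩⟩
      exact ((measurable_maxKernel fun k : Fin n =>
        (S.measurable_proj_comp k).pow_const 2).div_const _).aestronglyMeasurable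
  · filter_upwards [S.ae_tendsto_meanSqProj] with ω hω
    exact tendsto_maxKernel_div (y := fun k => proj μ X r (X k ω) ^ 2) (fun _ => sq_nonneg _) hω

theorem tendstoInMeasure_meanSqRem (S : IsMaxSample μ X r) {β : ℝ}
    (hβ : meanMax μ X r = ((r : ℝ) + 1) * β) :
    TendstoInMeasure μ (meanSqRem μ X r β) atTop fun _ => 0 := by
  obtain ⟨C, hC⟩ := S.exists_integral_sq_pseudoValue_sub_le hβ
  refine tendstoInMeasure_zero_of_integral_le (c := fun n => C / ((n : ℝ) - 1))
    (fun n ω => div_nonneg (Finset.sum_nonneg fun _ _ => sq_nonneg _) (Nat.cast_nonneg n)) ?_ ?_ ?_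
  · filter_upwards [eventually_ge_atTop (r + 2)] with n hn
    exact (integrable_finsetSum _ fun k hk =>
      (hC n hn k (Finset.mem_range.1 hk)).1.integrable_sq).div_const _
  · filter_upwards [eventually_ge_atTop (r + 2)] with n hn
    have hn' : 0 < n := by omega
    simp only [meanSqRem]
    rw [integral_div, integral_finsetSum _ fun k hk =>
      (hC n hn k (Finset.mem_range.1 hk)).1.integrable_sq, div_le_iff₀ (by positivity)]
    refine (Finset.sum_le_sum fun k hk => (hC n hn k (Finset.mem_range.1 hk)).2).trans_eq ?_
    rw [Finset.sum_const, Finset.card_range, nsmul_eq_mul, mul_comm]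
  · exact tendsto_const_nhds.div_atTop
      (tendsto_atTop_add_const_right _ _ tendsto_natCast_atTop_atTop)

theorem tendstoInMeasure_meanSq (S : IsMaxSample μ X r) {β : ℝ}
    (hβ : meanMax μ X r = ((r : ℝ) + 1) * β) :
    TendstoInMeasure μ (meanSq X r β) atTop fun _ => ∫ ω, proj μ X r (X 0 ω) ^ 2 ∂μ := by
  set σ2 := ∫ ω, proj μ X r (X 0 ω) ^ 2 ∂μ with hσ
  refine tendstoInMeasure_of_abs_sub_le
    (Y := ![meanSqProj μ X r, meanSqRem μ X r β]) (c := ![σ2, 0])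
    (Φ := fun x => |x 0 - σ2| + (x 1 + 2 * √(x 0 * x 1))) ?_ ?_ ?_ one_pos ?_
  · intro i
    fin_cases i
    · exact S.tendstoInMeasure_meanSqProj
    · exact S.tendstoInMeasure_meanSqRem hβ
  · exact Continuous.continuousAt (by fun_prop)
  · simp
  · refine Eventually.of_forall fun n ω _ => ?_
    have h := abs_meanSq_sub_meanSqProj_le (μ := μ) (X := X) (r := r) β n ω
    have h' := abs_sub_le (meanSq X r β n ω) (meanSqProj μ X r n ω) σ2
    simp only [Matrix.cons_val_zero, Matrix.cons_val_one]
    linarith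

theorem memLp_normError (S : IsMaxSample μ X r) (n : ℕ) : MemLp (normError μ X r n) 2 μ :=
  (((S.memLp_uStat_subMax _).sub (memLp_const _)).const_mul _).const_mul _

theorem exists_integral_sq_normError_le (S : IsMaxSample μ X r) :
    ∃ C : ℝ, ∀ᶠ n in atTop, ∫ ω, normError μ X r n ω ^ 2 ∂μ ≤ C := by
  obtain ⟨C, hC, h⟩ := S.exists_integral_sq_uStat_sub_le
  refine ⟨(1 / ((r : ℝ) + 1)) ^ 2 * C, ?_⟩
  filter_upwards [eventually_ge_atTop (r + 1)] with n hn
  have hn' : (0 : ℝ) < n := by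
    have : 0 < n := by omega
    positivity
  have h1 := h (Finset.range n) (by simpa using hn)
  rw [Finset.card_range] at h1
  simp only [normError, mul_pow, Real.sq_sqrt hn'.le]
  rw [integral_const_mul, integral_const_mul]
  calc (n : ℝ) * ((1 / ((r : ℝ) + 1)) ^ 2 * _)
      ≤ (n : ℝ) * ((1 / ((r : ℝ) + 1)) ^ 2 * (C / n)) := by gcongr
    _ = _ := by field_simp

/-- The normalized estimation error is asymptotically equivalent to a normalized sum of independent
variables. -/
theorem tendstoInMeasure_normError_sub (S : IsMaxSample μ X r) :
    TendstoInMeasure μ (fun n ω => normError μ X r n ω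
      - (√n)⁻¹ * ∑ k ∈ Finset.range n, proj μ X r (X k ω)) atTop fun _ => 0 := by
  obtain ⟨C, hC, h⟩ := S.exists_integral_sq_uStat_sub_sum_le
  have hL : ∀ n, MemLp (fun ω => normError μ X r n ω
      - (√n)⁻¹ * ∑ k ∈ Finset.range n, proj μ X r (X k ω)) 2 μ := fun n =>
    (S.memLp_normError n).sub ((memLp_finsetSum _ fun k _ => S.memLp_proj k).const_mul _)
  refine tendstoInMeasure_zero_of_integral_sq_le
    (c := fun n => 2 * C * (1 / ((r : ℝ) + 1)) ^ 2 / ((n : ℝ) - 1)) (Eventually.of_forall hL) ?_ ?_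
  · filter_upwards [eventually_ge_atTop (r + 2)] with n hn
    have hn' : (0 : ℝ) < n := by
      have : 0 < n := by omega
      positivity
    have hn1 : (0 : ℝ) < (n : ℝ) - 1 := by
      have : (2 : ℝ) ≤ n := by exact_mod_cast (show 2 ≤ n by omega)
      linarith
    have h1 := h (Finset.range n) (by rw [Finset.card_range]; omega)
    rw [Finset.card_range, Nat.cast_choose_two] at h1
    have e : ∀ ω, (normError μ X r n ω - (√n)⁻¹ * ∑ k ∈ Finset.range n, proj μ X r (X k ω)) ^ 2
        = n * ((1 / ((r : ℝ) + 1)) ^ 2 *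
          (uStat (r + 1) (fun A => subMax X A ω) (Finset.range n) - meanMax μ X r
          - ((r : ℝ) + 1) / n * ∑ i ∈ Finset.range n, proj μ X r (X i ω)) ^ 2) := by
      intro ω
      have hs : √(n : ℝ) ≠ 0 := (Real.sqrt_pos.2 hn').ne'
      have hs2 : √(n : ℝ) ^ 2 = n := Real.sq_sqrt hn'.le
      have : normError μ X r n ω - (√n)⁻¹ * ∑ k ∈ Finset.range n, proj μ X r (X k ω)
          = √n * (1 / ((r : ℝ) + 1) *
          (uStat (r + 1) (fun A => subMax X A ω) (Finset.range n) - meanMax μ X r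
          - ((r : ℝ) + 1) / n * ∑ i ∈ Finset.range n, proj μ X r (X i ω))) := by
        rw [normError, ← Real.sqrt_div_self]
        field_simp
      rw [this, mul_pow, mul_pow, hs2]
    simp_rw [e]
    rw [integral_const_mul, integral_const_mul]
    calc (n : ℝ) * ((1 / ((r : ℝ) + 1)) ^ 2 * _)
        ≤ (n : ℝ) * ((1 / ((r : ℝ) + 1)) ^ 2 * (C / (n * ((n : ℝ) - 1) / 2))) := by gcongr
      _ = _ := by field_simp
  · exact tendsto_const_nhds.div_atTop
      (tendsto_atTop_add_const_right _ _ tendsto_natCast_atTop_atTop)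

end IsMaxSample

end Limits

/-! ### Wilks' theorem for the jackknife empirical likelihood. -/

section Wilks

variable {Ω : Type*} [MeasurableSpace Ω] {μ : Measure Ω} {X : ℕ → Ω → ℝ} {r : ℕ}

/-- The product of the normalized estimation error and of the normalized bound on the
pseudo-values, which controls the quadratic expansion of the log-likelihood ratio. -/
noncomputable def expansionError (μ : Measure Ω) (X : ℕ → Ω → ℝ) (r : ℕ) (β : ℝ) (n : ℕ) (ω : Ω) :
    ℝ :=
  normError μ X r n ω * √(2 * maxSqProj μ X r n ω + 2 * meanSqRem μ X r β n ω)

/-- The factor `√n` in the bound on the pseudo-values is the one that normalises their mean, so `|b|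
* Z` is exactly `|expansionError|` and the smallness condition involves only convergent quantities.
-/
theorem jelLogRatio_expansion {β : ℝ} (hβ : meanMax μ X r = ((r : ℝ) + 1) * β) {n : ℕ}
    (hn : r + 2 ≤ n) {ω : Ω} (hS : 0 < meanSq X r β n ω)
    (hT : 8 * |expansionError μ X r β n ω| ≤ meanSq X r β n ω) :
    (∃ t : ℝ, IsMultiplier (fun k : Fin n => pseudoValue r (fun i => X i ω) n k) β t ∧
      jelLogRatio r (fun i => X i ω) n β = -∑ k : Fin n, Real.log
        (1 + t * (pseudoValue r (fun i => X i ω) n k - β))) ∧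
    |-2 * jelLogRatio r (fun i => X i ω) n β - normError μ X r n ω ^ 2 / meanSq X r β n ω|
      ≤ 40 * (normError μ X r n ω ^ 2 / meanSq X r β n ω)
        * (|expansionError μ X r β n ω| / meanSq X r β n ω) := by
  have hn0 : 0 < n := by omega
  set b := 1 / (n : ℝ) * ∑ k : Fin n, (pseudoValue r (fun i => X i ω) n k - β) with hb
  set Z := √n * √(2 * maxSqProj μ X r n ω + 2 * meanSqRem μ X r β n ω) with hZ
  have hA : normError μ X r n ω = √n * b := by rw [hb, mean_pseudoValue_sub hβ hn ω, normError]
  have hbZ : |b| * Z = |expansionError μ X r β n ω| := by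
    have hZ0 : 0 ≤ Z := mul_nonneg (Real.sqrt_nonneg _) (Real.sqrt_nonneg _)
    have e : expansionError μ X r β n ω = b * Z := by
      rw [expansionError, hA, hZ]
      ring
    rw [e, abs_mul b Z, abs_of_nonneg hZ0]
  have hA2 : normError μ X r n ω ^ 2 = n * b ^ 2 := by
    rw [hA, mul_pow, Real.sq_sqrt (Nat.cast_nonneg n)]
  rw [← hbZ] at hT ⊢
  rw [hA2]
  obtain ⟨t, ht, -⟩ := exists_isMultiplier
    (V := fun k : Fin n => pseudoValue r (fun i => X i ω) n k) (β := β) (fun _ => rfl)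
    (fun k => abs_pseudoValue_sub_le (μ := μ) β k ω) rfl hb hS hT
  exact ⟨⟨t, ht, ht.logRatio_eq hn0⟩, abs_neg_two_mul_logRatio_sub_le
    (V := fun k : Fin n => pseudoValue r (fun i => X i ω) n k) (β := β) (fun _ => rfl)
    (fun k => abs_pseudoValue_sub_le (μ := μ) β k ω) rfl hb hS hT⟩

/-- The margin leaves `s > 15 / 16 * σ2`, while `8 * |T| < σ2 / 2`. -/
theorem expansion_conditions {T s σ2 : ℝ} (hσ : 0 < σ2) (hT : |T| < σ2 / 16)
    (hs : |s - σ2| < σ2 / 16) : 0 < s ∧ 8 * |T| ≤ s := by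
  have := (abs_lt.1 hs).1
  constructor <;> linarith

namespace IsMaxSample

variable [IsProbabilityMeasure μ]

theorem tendstoInMeasure_expansionError (S : IsMaxSample μ X r) {β : ℝ}
    (hβ : meanMax μ X r = ((r : ℝ) + 1) * β) :
    TendstoInMeasure μ (expansionError μ X r β) atTop fun _ => 0 := by
  obtain ⟨C, hC⟩ := S.exists_integral_sq_normError_le
  refine tendstoInMeasure_mul_of_integral_sq_le (Eventually.of_forall S.memLp_normError) hC ?_
  refine tendstoInMeasure_of_abs_sub_le (Y := ![maxSqProj μ X r, meanSqRem μ X r β])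
    (c := ![0, 0]) (Φ := fun x => √(2 * x 0 + 2 * x 1)) ?_ ?_ ?_ one_pos ?_
  · intro i
    fin_cases i
    · exact S.tendstoInMeasure_maxSqProj
    · exact S.tendstoInMeasure_meanSqRem hβ
  · exact Continuous.continuousAt (by fun_prop)
  · simp
  · refine Eventually.of_forall fun n ω _ => ?_
    simp [abs_of_nonneg (Real.sqrt_nonneg _)]

theorem tendstoInMeasure_pair (S : IsMaxSample μ X r) {β : ℝ}
    (hβ : meanMax μ X r = ((r : ℝ) + 1) * β) (i : Fin 2) :
    TendstoInMeasure μ (![expansionError μ X r β, meanSq X r β] i) atTop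
      fun _ => (![0, ∫ ω, proj μ X r (X 0 ω) ^ 2 ∂μ] : Fin 2 → ℝ) i := by
  fin_cases i
  · exact S.tendstoInMeasure_expansionError hβ
  · exact S.tendstoInMeasure_meanSq hβ

theorem tendsto_measure_exists_isMultiplier (S : IsMaxSample μ X r) {β : ℝ}
    (hβ : meanMax μ X r = ((r : ℝ) + 1) * β) (hσ : 0 < ∫ ω, proj μ X r (X 0 ω) ^ 2 ∂μ) :
    Tendsto (fun n : ℕ => μ {ω | ∃ t : ℝ,
        IsMultiplier (fun k : Fin n => pseudoValue r (fun i => X i ω) n k) β t ∧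
        jelLogRatio r (fun i => X i ω) n β = -∑ k : Fin n, Real.log
          (1 + t * (pseudoValue r (fun i => X i ω) n k - β))}) atTop (𝓝 1) := by
  refine tendsto_measure_one_of_forall (S.tendstoInMeasure_pair hβ)
    (div_pos hσ (by norm_num : (0 : ℝ) < 16)) ?_
  filter_upwards [eventually_ge_atTop (r + 2)] with n hn ω hω
  have h0 := hω 0
  have h1 := hω 1
  simp only [Matrix.cons_val_zero, Matrix.cons_val_one, sub_zero] at h0 h1
  obtain ⟨hS, hT⟩ := expansion_conditions hσ h0 h1
  exact (jelLogRatio_expansion hβ hn hS hT).1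

theorem tendstoInMeasure_jelLogRatio_sub (S : IsMaxSample μ X r) {β : ℝ}
    (hβ : meanMax μ X r = ((r : ℝ) + 1) * β) (hσ : 0 < ∫ ω, proj μ X r (X 0 ω) ^ 2 ∂μ) :
    TendstoInMeasure μ (fun n ω => -2 * jelLogRatio r (fun i => X i ω) n β
      - normError μ X r n ω ^ 2 / ∫ ω, proj μ X r (X 0 ω) ^ 2 ∂μ) atTop fun _ => 0 := by
  obtain ⟨C, hC⟩ := S.exists_integral_sq_normError_le
  have hpair := S.tendstoInMeasure_pair hβ
  set σ2 := ∫ ω, proj μ X r (X 0 ω) ^ 2 ∂μ with hσ2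
  set D : ℕ → Ω → ℝ := fun n ω => -2 * jelLogRatio r (fun i => X i ω) n β
      - normError μ X r n ω ^ 2 / σ2 with hD
  have hδ : 0 < σ2 / 16 := by positivity
  have hbound : ∀ n, r + 2 ≤ n → ∀ ω, |expansionError μ X r β n ω| < σ2 / 16 →
      |meanSq X r β n ω - σ2| < σ2 / 16 → |D n ω| ≤ normError μ X r n ω ^ 2 *
        (40 * |expansionError μ X r β n ω| / meanSq X r β n ω ^ 2
          + |1 / meanSq X r β n ω - 1 / σ2|) := by
    intro n hn ω hT hs
    obtain ⟨hs0, hT8⟩ := expansion_conditions hσ hT hs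
    have h := (jelLogRatio_expansion hβ hn hs0 hT8).2
    have e : D n ω = (-2 * jelLogRatio r (fun i => X i ω) n β
        - normError μ X r n ω ^ 2 / meanSq X r β n ω)
        + normError μ X r n ω ^ 2 * (1 / meanSq X r β n ω - 1 / σ2) := by
      simp only [hD]
      ring
    rw [e, mul_add]
    refine (abs_add_le _ _).trans (add_le_add (h.trans_eq ?_) ?_)
    · field_simp
    · rw [abs_mul, abs_of_nonneg (sq_nonneg (normError μ X r n ω))]
  -- The square of `normError` is bounded only in mean, whereas the product lemma wants a factor
  -- bounded in mean square. So `D` is divided by the square, and the quotient is multiplied back by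
  -- `normError` twice.
  have hw : TendstoInMeasure μ (fun n ω => D n ω / normError μ X r n ω ^ 2) atTop fun _ => 0 := by
    refine tendstoInMeasure_of_abs_sub_le hpair
      (Φ := fun x => 40 * |x 0| / x 1 ^ 2 + |1 / x 1 - 1 / σ2|) ?_ ?_ hδ ?_
    · have h1 : ContinuousAt (fun x : Fin 2 → ℝ => x 1) ![0, σ2] :=
        Continuous.continuousAt (by fun_prop)
      have h2 : ContinuousAt (fun x : Fin 2 → ℝ => |x 0|) ![0, σ2] :=
        Continuous.continuousAt (by fun_prop)
      refine ((h2.const_mul 40).div (h1.pow 2) ?_).add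
        (((continuousAt_const.div h1 ?_).sub continuousAt_const).abs)
      · simpa using hσ.ne'
      · simpa using hσ.ne'
    · simp
    · filter_upwards [eventually_ge_atTop (r + 2)] with n hn ω hω
      have h0 := hω 0
      have h1 := hω 1
      simp only [Matrix.cons_val_zero, Matrix.cons_val_one, sub_zero] at h0 h1 ⊢
      rw [abs_div, abs_of_nonneg (sq_nonneg (normError μ X r n ω))]
      refine div_le_of_le_mul₀ (sq_nonneg _) (by positivity) ?_
      rw [mul_comm]
      exact hbound n hn ω h0 h1
  have hAw := tendstoInMeasure_mul_of_integral_sq_le (Eventually.of_forall S.memLp_normError) hC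
    (tendstoInMeasure_mul_of_integral_sq_le (Eventually.of_forall S.memLp_normError) hC hw)
  refine tendstoInMeasure_of_abs_sub_le
    (Y := ![expansionError μ X r β, meanSq X r β,
      fun n ω => normError μ X r n ω * (normError μ X r n ω *
        (D n ω / normError μ X r n ω ^ 2))])
    (c := ![0, σ2, 0]) (Φ := fun x => |x 2|) ?_ ?_ ?_ hδ ?_
  · intro i
    fin_cases i
    · exact hpair 0
    · exact hpair 1
    · exact hAw
  · exact Continuous.continuousAt (by fun_prop)
  · simp
  · filter_upwards [eventually_ge_atTop (r + 2)] with n hn ω hω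
    have h0 := hω 0
    have h1 := hω 1
    simp only [Matrix.cons_val_zero, Matrix.cons_val_one, sub_zero] at h0 h1
    have h2 := hbound n hn ω h0 h1
    change |D n ω - 0| ≤ |normError μ X r n ω * (normError μ X r n ω *
        (D n ω / normError μ X r n ω ^ 2))|
    rw [sub_zero]
    -- Where `normError` vanishes the quotient is `0` by convention, but there the bound forces `D =
    -- 0` too.
    rcases eq_or_ne (normError μ X r n ω) 0 with hA | hA
    · rw [hA] at h2 ⊢
      simpa using h2
    · refine le_of_eq (congrArg _ ?_)
      field_simp

theorem tendstoInDistribution_normError (S : IsMaxSample μ X r)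
    (hσ : 0 < ∫ ω, proj μ X r (X 0 ω) ^ 2 ∂μ) :
    TendstoInDistribution
      (fun n ω => normError μ X r n ω / √(∫ ω, proj μ X r (X 0 ω) ^ 2 ∂μ)) atTop
      (fun z : Fin 1 → ℝ => z 0) (fun _ => μ) (Measure.pi fun _ : Fin 1 => gaussianReal 0 1) := by
  set σ2 := ∫ ω, proj μ X r (X 0 ω) ^ 2 ∂μ with hσ2
  have hY : HasLaw (fun z : Fin 1 → ℝ => z 0) (gaussianReal 0 1)
      (Measure.pi fun _ : Fin 1 => gaussianReal 0 1) :=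
    ⟨(measurable_pi_apply 0).aemeasurable,
      (measurePreserving_eval (fun _ : Fin 1 => gaussianReal 0 1) 0).map_eq⟩
  -- The projections are scaled to unit variance; the estimation error then inherits the limit
  -- because its difference from the normalised sum vanishes in probability.
  have hclt := tendstoInDistribution_inv_sqrt_mul_sum (P := μ)
    (X := fun k ω => proj μ X r (X k ω) / √σ2) hY ?_ ?_
    (S.indep_proj.comp (fun _ x => x / √σ2) (by fun_prop))
    (fun k => (S.identDistrib_proj k).comp (u := fun x => x / √σ2) (by fun_prop))
  · refine tendstoInDistribution_of_tendstoInMeasure_sub _ _ hclt ?_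
      fun n => ((S.measurable_normError n).div_const _).aemeasurable
    change TendstoInMeasure μ _ atTop fun _ => (0 : ℝ)
    refine tendstoInMeasure_of_abs_sub_le (Y := fun _ : Unit => fun n ω => normError μ X r n ω
      - (√n)⁻¹ * ∑ k ∈ Finset.range n, proj μ X r (X k ω)) (c := fun _ => 0)
      (fun _ => S.tendstoInMeasure_normError_sub) (Φ := fun x => |x () / √σ2|) ?_ ?_ one_pos ?_
    · exact Continuous.continuousAt (by fun_prop)
    · simp
    · refine Eventually.of_forall fun n ω _ => le_of_eq ?_
      simp only [Pi.sub_apply, sub_zero]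
      rw [← Finset.sum_div]
      congr 1
      ring
  · rw [integral_div, S.integral_proj, zero_div]
  · simp only [Pi.pow_apply, div_pow]
    rw [integral_div, Real.sq_sqrt hσ.le, div_self hσ.ne']

theorem tendstoInDistribution_jelLogRatio (S : IsMaxSample μ X r) {β : ℝ}
    (hβ : meanMax μ X r = ((r : ℝ) + 1) * β) (hσ : 0 < ∫ ω, proj μ X r (X 0 ω) ^ 2 ∂μ) :
    TendstoInDistribution (fun (n : ℕ) ω => -2 * jelLogRatio r (fun i => X i ω) n β)
      atTop (id : ℝ → ℝ) (fun _ => μ) (chiSquare 1) := by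
  have h1 := (S.tendstoInDistribution_normError hσ).continuous_comp
    (g := fun x : ℝ => x ^ 2) (by fun_prop)
  have h2 := tendstoInDistribution_of_tendstoInMeasure_sub
    (fun (n : ℕ) ω => -2 * jelLogRatio r (fun i => X i ω) n β) _ h1 ?_
    fun n => ((S.measurable_jelLogRatio n β).const_mul _).aemeasurable
  · refine ⟨h2.forall_aemeasurable, aemeasurable_id, ?_⟩
    have hmap : (chiSquare 1).map id
        = (Measure.pi fun _ : Fin 1 => gaussianReal 0 1).map
          ((fun x : ℝ => x ^ 2) ∘ fun z : Fin 1 → ℝ => z 0) := by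
      rw [Measure.map_id, chiSquare]
      congr 1
      ext z
      simp
    convert h2.tendsto using 1
    exact congrArg 𝓝 (Subtype.ext hmap)
  · convert S.tendstoInMeasure_jelLogRatio_sub hβ hσ using 1
    · ext n ω
      simp [div_pow, Real.sq_sqrt hσ.le]
    · rfl

end IsMaxSample

end Wilks

end JEL

theorem theorem1 {Ω : Type*} [MeasurableSpace Ω] (μ : Measure Ω) [IsProbabilityMeasure μ]
    (r : ℕ) (hr : 1 ≤ r) (X : ℕ → Ω → ℝ)
    (hmeas : ∀ i, Measurable (X i))
    (hindep : iIndepFun X μ)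
    (hident : ∀ i, IdentDistrib (X i) (X 0) μ μ)
    (hcont : ∀ x : ℝ, x ≠ 0 → ContinuousAt (cdf (μ.map (X 0))) x)
    (hsq : Integrable (fun ω => (JEL.maxKernel (fun j : Fin (r + 1) => X j ω)) ^ 2) μ)
    (hvar : 0 < Var[fun ω => JEL.projection μ r X (X 0 ω); μ]) :
    Tendsto
        (fun n : ℕ => μ {ω | ∃ t : ℝ,
          JEL.IsMultiplier (fun k : Fin n => JEL.pseudoValue r (fun i => X i ω) n k)
            (JEL.pwm r (μ.map (X 0))) t ∧
          JEL.jelLogRatio r (fun i => X i ω) n (JEL.pwm r (μ.map (X 0))) =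
            -∑ k : Fin n, Real.log
              (1 + t * (JEL.pseudoValue r (fun i => X i ω) n k - JEL.pwm r (μ.map (X 0))))})
        atTop (𝓝 1) ∧
      TendstoInDistribution
        (fun (n : ℕ) ω =>
          -2 * JEL.jelLogRatio r (fun i => X i ω) n (JEL.pwm r (μ.map (X 0))))
        atTop (id : ℝ → ℝ) (fun _ => μ) (JEL.chiSquare 1) := by
  have hm : Measurable (JEL.subMax X (Finset.range (r + 1))) :=
    JEL.measurable_subMax (by simp) fun i _ => hmeas i
  have S : JEL.IsMaxSample μ X r :=
    ⟨hmeas, hindep, hident, hr, (memLp_two_iff_integrable_sq hm.aestronglyMeasurable).2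
      (by simpa only [JEL.maxKernel_fin_eq] using hsq)⟩
  have hβ := S.meanMax_eq hcont
  rw [S.variance_projection] at hvar
  exact ⟨S.tendsto_measure_exists_isMultiplier hβ hvar,
    S.tendstoInDistribution_jelLogRatio hβ hvar⟩
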